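/- **Setting.** Let $\mathcal X=\prod_{i=1}^n[0,u_i]$ with $u_i>0$, and let $\mathcal C\subseteq\mathcal X$ be nonempty, convex and compact. Let $\nu$ be a $\sigma$-finite measure on a measurable space $\mathcal Z$. For every $x\in\mathcal X$ let $p(\cdot;x)>0$ be a probability density with respect to $\nu$, and let $\tilde F:\mathcal X\times\mathcal Z\to\mathbb R$. Suppose $\tilde F$ and $p$ are measurable in $z$, and $\tilde F(x,z)$ and $\log p(z;x)$ are twice continuously differentiable in $x\in\mathcal X$; all gradients and Hessians of $\tilde F$ and $\log p$ are in $x$, and matrix norms are operator norms. Put $F(x)=\mathbb E_{z\sim p(\cdot;x)}[\tilde F(x,z)]$ and $OPT=\max_{x\in\mathcal C}F(x)$. Assume that, for all $x,y\in\mathcal X$ and $z\in\mathcal Z$ (unless said otherwise): * $F$ is monotone ($x\le y$ coordinatewise implies $F(x)\le F(y)$) and DR-submodular: $F(x+ke_i)-F(x)\ge F(y+ke_i)-F(y)$ whenever $x\le y$, $k\ge0$ and $x,y,x+ke_i,y+ke_i\in\mathcal X$; * $\|x-y\|\le D$ and $\|x\|\le D$ for all $x,y\in\mathcal C$ (the second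 bound follows from the first if $0\in\mathcal C$); * $F(0)\ge 0$; * $|\tilde F(x,z)|\le B$, $\|\nabla\tilde F(x,z)\|\le G_{\tilde F}$, $\|\nabla^2\tilde F(x,z)\|\le L_{\tilde F}$; * $\mathbb E_{z\sim p(\cdot;x)}\|\nabla\log p(z;x)\|^4\le G_p^4$ and $\mathbb E_{z\sim p(\cdot;x)}\|\nabla^2\log p(z;x)\|^2\le L_p^2$, with $G_p,L_p\ge0$; * $\|\nabla^2\tilde F(x,z)-\nabla^2\tilde F(y,z)\|\le L_{2,\tilde F}\|x-y\|$ and $\|\nabla^2\log p(z;x)-\nabla^2\log p(z;y)\|\le L_{2,p}\|x-y\|$. Let $L\ge0$ satisfy $L^2\ge 4B^2G_p^4+16G_{\tilde F}^2G_p^2+4L_{\tilde F}^2+4B^2L_p^2$. **Algorithm (SCG++).** For $(x,z)$ put $\tilde\nabla F=\nabla\tilde F+\tilde F\,\nabla\log p$ and $$\tilde\nabla^2F=\nabla^2\tilde F+\nabla\tilde F(\nabla\log p)^\top+\nabla\log p\,(\nabla\tilde F)^\top+\tilde F\,\bigl(\nabla^2\log p+\nabla\log p\,(\nabla\log p)^\top\bigr).$$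 Given $T\ge1$ and $M_0\ge1$, start from $x_0=0$. Let $\hat g_0$ be the average of $\tilde\nabla F(x_0,z)$ over $M_0$ independent samples $z\sim p(\cdot;x_0)$. For $1\le t<T$ draw, independently given the past, $T$ pairs $(a,z(a))$ with $a$ uniform on $[0,1]$ and $z(a)\sim p(\cdot;x(a))$, where $x(a)=ax_t+(1-a)x_{t-1}$; let $\tilde\nabla_t^2$ be the average of $\tilde\nabla^2F(x(a),z(a))$ over these pairs, and put $\hat g_t=\hat g_{t-1}+\tilde\nabla_t^2(x_t-x_{t-1})$. For $0\le t<T$ choose $v_t\in\arg\max_{v\in\mathcal C}\langle\hat g_t,v\rangle$ (ties are broken arbitrarily, possibly at random, without looking ahead) and put $x_{t+1}=x_t+\frac1Tv_t$. The initial batch is so large that $(G_{\tilde F}+BG_p)^2T^2\le M_0L^2D^2$. Let $K=M_0+(T-1)T$ be the total number of samples drawn (oracle queries). **Statement.** Let $0\le p<1$ be a confidence level. Then with probability greater than $p$, $$F(x_T)\ \ge\ \Bigl(1-\frac1e\Bigr)OPT-\frac{LD^2}{\sqrt{1-p}}\,\frac1{\sqrt T}-\frac{LD^2}{2T^2}.$$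 Moreover, for every $\kappa$ there is a constant $A$ depending only on $p,L,D,\kappa$ such that, whenever $M_0\le\kappa T^2$, one has $\frac34T^2\le K\le(\kappa+1)T^2$ and, with probability greater than $p$, $$F(x_T)\ \ge\ \Bigl(1-\frac1e\Bigr)OPT-\frac{A}{K^{1/4}}.$$ -/

import Mathlib

open MeasureTheory
open scoped InnerProductSpace

noncomputable section

/-- The data of a stochastic continuous maximization problem in which the law of the random
variable `z` may depend on the decision variable `x`.
`u` : upper corner of the box `𝒳 = ∏ i, [0, u i]`; `C` : the constraint set;
`ν` : the reference measure on the sample space `Z`; `Ft x z` : the stochastic function `F̃(x, z)`;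
`p x z` : the density `p(z; x)` with respect to `ν` of the law of `z` at the point `x`. -/
structure StochProblem (n : ℕ) (Z : Type*) [MeasurableSpace Z] where
  u : Fin n → ℝ
  C : Set (EuclideanSpace ℝ (Fin n))
  ν : Measure Z
  Ft : EuclideanSpace ℝ (Fin n) → Z → ℝ
  p : EuclideanSpace ℝ (Fin n) → Z → ℝ

namespace StochProblem

variable {n : ℕ} {Z : Type*} [MeasurableSpace Z] (Q : StochProblem n Z)

/-- The box `𝒳 = ∏ i, [0, u i]`. -/
def box : Set (EuclideanSpace ℝ (Fin n)) := {x | ∀ i, 0 ≤ x i ∧ x i ≤ Q.u i}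

/-- The law `p(·; x)` of the random variable `z` at the point `x`. -/
def sampleLaw (x : EuclideanSpace ℝ (Fin n)) : Measure Z :=
  Q.ν.withDensity (fun z => ENNReal.ofReal (Q.p x z))

/-- The objective `F(x) = 𝔼_{z ∼ p(·; x)} [F̃(x, z)]`. -/
def F (x : EuclideanSpace ℝ (Fin n)) : ℝ := ∫ z, Q.Ft x z ∂(Q.sampleLaw x)

/-- `OPT = max_{x ∈ C} F(x)`. -/
def OPT : ℝ := sSup (Q.F '' Q.C)

/-- `∇F̃(x, z)`, the gradient in `x`, relative to the box. -/
def gradFt (x : EuclideanSpace ℝ (Fin n)) (z : Z) : EuclideanSpace ℝ (Fin n) :=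
  gradientWithin (fun y => Q.Ft y z) Q.box x

/-- `∇²F̃(x, z)`, the Hessian in `x`, as a linear operator. -/
def hessFt (x : EuclideanSpace ℝ (Fin n)) (z : Z) :
    EuclideanSpace ℝ (Fin n) →L[ℝ] EuclideanSpace ℝ (Fin n) :=
  fderivWithin ℝ (fun y => Q.gradFt y z) Q.box x

/-- `∇ log p(z; x)`, the gradient in `x`. -/
def gradLogp (x : EuclideanSpace ℝ (Fin n)) (z : Z) : EuclideanSpace ℝ (Fin n) :=
  gradientWithin (fun y => Real.log (Q.p y z)) Q.box x

/-- `∇² log p(z; x)`, the Hessian in `x`, as a linear operator. -/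
def hessLogp (x : EuclideanSpace ℝ (Fin n)) (z : Z) :
    EuclideanSpace ℝ (Fin n) →L[ℝ] EuclideanSpace ℝ (Fin n) :=
  fderivWithin ℝ (fun y => Q.gradLogp y z) Q.box x

/-- The one-sample unbiased estimate of `∇F(x)`: `∇F̃ + F̃ ∇ log p`, at `(x, z)`. -/
def gradEst (x : EuclideanSpace ℝ (Fin n)) (z : Z) : EuclideanSpace ℝ (Fin n) :=
  Q.gradFt x z + Q.Ft x z • Q.gradLogp x z

/-- The one-sample unbiased estimate of `∇²F(x)`, at `(x, z)`:
`∇²F̃ + ∇F̃ (∇ log p)ᵀ + ∇ log p (∇F̃)ᵀ + F̃ (∇² log p + ∇ log p (∇ log p)ᵀ)`. -/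
def hessEst (x : EuclideanSpace ℝ (Fin n)) (z : Z) :
    EuclideanSpace ℝ (Fin n) →L[ℝ] EuclideanSpace ℝ (Fin n) :=
  Q.hessFt x z
    + (innerSL ℝ (Q.gradLogp x z)).smulRight (Q.gradFt x z)
    + (innerSL ℝ (Q.gradFt x z)).smulRight (Q.gradLogp x z)
    + Q.Ft x z •
      (Q.hessLogp x z + (innerSL ℝ (Q.gradLogp x z)).smulRight (Q.gradLogp x z))

/-- The law of a pair `(a, z(a))`: `a` is uniform on `[0, 1]` and, given `a`, the law of `z(a)` is
`p(·; x(a))` with `x(a) = a x + (1 - a) y`. -/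
def pairLaw (x y : EuclideanSpace ℝ (Fin n)) : Measure (ℝ × Z) :=
  ((volume.restrict (Set.Icc (0 : ℝ) 1)).prod Q.ν).withDensity
    (fun az => ENNReal.ofReal (Q.p (az.1 • x + (1 - az.1) • y) az.2))

/-- `F` is monotone on the box. -/
def MonotoneObjective : Prop :=
  ∀ x ∈ Q.box, ∀ y ∈ Q.box, (∀ i, x i ≤ y i) → Q.F x ≤ Q.F y

/-- `F` has the diminishing returns property on the box. -/
def DRObjective : Prop :=
  ∀ x ∈ Q.box, ∀ y ∈ Q.box, (∀ i, x i ≤ y i) → ∀ (i : Fin n) (k : ℝ), 0 ≤ k →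
    x + EuclideanSpace.single i k ∈ Q.box → y + EuclideanSpace.single i k ∈ Q.box →
    Q.F (y + EuclideanSpace.single i k) - Q.F y ≤ Q.F (x + EuclideanSpace.single i k) - Q.F x

/-- The assumptions on the problem. -/
structure Assumptions (D B GF LF Gp Lp L2F L2p : ℝ) : Prop where
  -- the domain and the constraint set
  u_pos : ∀ i, 0 < Q.u i
  C_subset : Q.C ⊆ Q.box
  C_convex : Convex ℝ Q.C
  C_compact : IsCompact Q.C
  C_nonempty : Q.C.Nonempty
  -- the family of laws and the stochastic function
  sigmaFinite : SigmaFinite Q.ν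
  p_measurable : ∀ x ∈ Q.box, Measurable (Q.p x)
  p_pos : ∀ x ∈ Q.box, ∀ z, 0 < Q.p x z
  p_prob : ∀ x ∈ Q.box, IsProbabilityMeasure (Q.sampleLaw x)
  logp_smooth : ∀ z, ContDiffOn ℝ 2 (fun x => Real.log (Q.p x z)) Q.box
  Ft_measurable : ∀ x ∈ Q.box, Measurable (Q.Ft x)
  Ft_smooth : ∀ z, ContDiffOn ℝ 2 (fun x => Q.Ft x z) Q.box
  -- the objective is monotone DR-submodular
  monotone : Q.MonotoneObjective
  dr : Q.DRObjective
  -- bounded diameter; the distances to the starting point `0` are bounded as well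
  diam_le : ∀ x ∈ Q.C, ∀ y ∈ Q.C, ‖x - y‖ ≤ D
  norm_le : ∀ x ∈ Q.C, ‖x‖ ≤ D
  -- value at the origin
  F_zero : 0 ≤ Q.F 0
  -- bounded stochastic function, gradient and Hessian
  Ft_bound : ∀ x ∈ Q.box, ∀ z, |Q.Ft x z| ≤ B
  gradFt_bound : ∀ x ∈ Q.box, ∀ z, ‖Q.gradFt x z‖ ≤ GF
  hessFt_bound : ∀ x ∈ Q.box, ∀ z, ‖Q.hessFt x z‖ ≤ LF
  -- bounded moments of the gradient and the Hessian of the log-density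
  Gp_nonneg : 0 ≤ Gp
  Lp_nonneg : 0 ≤ Lp
  gradLogp_bound : ∀ x ∈ Q.box,
    ∫⁻ z, ENNReal.ofReal (‖Q.gradLogp x z‖ ^ 4) ∂(Q.sampleLaw x) ≤ ENNReal.ofReal (Gp ^ 4)
  hessLogp_bound : ∀ x ∈ Q.box,
    ∫⁻ z, ENNReal.ofReal (‖Q.hessLogp x z‖ ^ 2) ∂(Q.sampleLaw x) ≤ ENNReal.ofReal (Lp ^ 2)
  -- Lipschitz continuous Hessians
  hessFt_lip : ∀ x ∈ Q.box, ∀ y ∈ Q.box, ∀ z,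
    ‖Q.hessFt x z - Q.hessFt y z‖ ≤ L2F * ‖x - y‖
  hessLogp_lip : ∀ x ∈ Q.box, ∀ y ∈ Q.box, ∀ z,
    ‖Q.hessLogp x z - Q.hessLogp y z‖ ≤ L2p * ‖x - y‖

/-- A run of Stochastic Continuous Greedy++ with `T` iterations, initial minibatch size `M₀` and
minibatch size `M`, on a probability space `(Ω, ℙ)`.
`x t` : iterates; `g t` : gradient estimates; `v t` : directions, a maximizer over `C` of the linear
function given by `g t`, with arbitrary and possibly random tie-breaking; `S₀` : the initial
minibatch; `S t` : the minibatch of pairs `(a, z(a))` of iteration `t ≥ 1`.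
`ℱ t` is the information available before the minibatch of iteration `t` is drawn; the law
conditions say that, conditionally on `ℱ t`, this minibatch consists of independent samples of the
prescribed law. -/
structure IsSCGPlusRun (T M₀ M : ℕ) {Ω : Type*} {mΩ : MeasurableSpace Ω} (ℙ : Measure Ω)
    (ℱ : Filtration ℕ mΩ) (x v g : ℕ → Ω → EuclideanSpace ℝ (Fin n))
    (S₀ : Ω → Fin M₀ → Z) (S : ℕ → Ω → Fin M → ℝ × Z) : Prop where
  x_zero : ∀ ω, x 0 ω = 0
  S₀_measurable : Measurable[ℱ 1] S₀
  S₀_law : ∀ A, MeasurableSet[ℱ 0] A → ∀ U : Set (Fin M₀ → Z), MeasurableSet U →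
    ℙ (A ∩ S₀ ⁻¹' U) = ℙ A * Measure.pi (fun _ : Fin M₀ => Q.sampleLaw 0) U
  g_zero : ∀ ω, g 0 ω = (M₀ : ℝ)⁻¹ • ∑ j, Q.gradEst 0 (S₀ ω j)
  v_measurable : ∀ t < T, Measurable[ℱ (t + 1)] (v t)
  v_mem : ∀ t < T, ∀ ω, v t ω ∈ Q.C
  v_max : ∀ t < T, ∀ ω, ∀ w ∈ Q.C, ⟪g t ω, w⟫_ℝ ≤ ⟪g t ω, v t ω⟫_ℝ
  x_succ : ∀ t < T, ∀ ω, x (t + 1) ω = x t ω + (1 / (T : ℝ)) • v t ω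
  S_measurable : ∀ t, t + 1 < T → Measurable[ℱ (t + 2)] (S (t + 1))
  S_law : ∀ t, t + 1 < T → ∀ A, MeasurableSet[ℱ (t + 1)] A →
    ∀ U : Set (Fin M → ℝ × Z), MeasurableSet U →
    ℙ (A ∩ S (t + 1) ⁻¹' U)
      = ∫⁻ ω in A, Measure.pi (fun _ : Fin M => Q.pairLaw (x (t + 1) ω) (x t ω)) U ∂ℙ
  g_succ : ∀ t, t + 1 < T → ∀ ω, g (t + 1) ω = g t ω +
    ((M : ℝ)⁻¹ • ∑ j, Q.hessEst
      ((S (t + 1) ω j).1 • x (t + 1) ω + (1 - (S (t + 1) ω j).1) • x t ω)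
      (S (t + 1) ω j).2) (x (t + 1) ω - x t ω)

end StochProblem

/-- The total number of oracle queries (samples drawn) in a run with `T` iterations: `M₀` in the
first iteration, and `M` in each of the others. -/
def scgPlusQueries (T M₀ M : ℕ) : ℕ := ∑ t ∈ Finset.range T, if t = 0 then M₀ else M

end

/-! For each fixed `z`, the identity ∇p = p ∇log p makes p·∇̃F the derivative of p·F̃, and p·∇̃²F
the derivative of p·∇̃F. Integrating these along a segment and exchanging the integrals over `a` and
`z` writes differences of F, and of its gradient field `gradF`, as expectations under `pairLaw`. No
differentiation under the integral sign is needed. Since ∇̃²F has second moment at most L², `gradF`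
is L-Lipschitz and F has a first-order expansion with error L/2 ‖x − y‖² (`abs_F_sub_sub_inner_le`).
Also, each increment of the algorithm's estimate is conditionally unbiased for the change of
`gradF`.

The estimation error is therefore a martingale. The cross terms vanish, and each step, of length at
most D/T and averaged over T samples, adds at most L²D²/T³ to the mean square; the initial batch
contributes at most L²D²/T² (`lintegral_estErr_le`).

Monotonicity and diminishing returns give F y − F x ≤ ⟨gradF x, y⟩ (`F_sub_le_inner_gradF`). Hence
the gap to any y in C contracts by 1 − 1/T per step, up to D/T times the error norm plus LD²/(2T²).
After T steps the loss beyond (1 − 1/e) OPT is at most (D/T) Σ‖error‖ + LD²/(2T) (`F_last_ge`). By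
Cauchy–Schwarz the second moment of the random term is of order (LD²)²/T², so a strict Chebyshev
inequality applies. The resulting radius is of order 1/T while the claim allows 1/√T; this slack
absorbs LD²/(2T) and leaves only LD²/(2T²) (`confidence_radius_bound`).

Joint measurability is obtained by composing with the retraction `clamp` onto the box, which changes
the estimates only on a null event. -/

section

open ProbabilityTheory Set Filter Topology

/-! ### Tools: Chebyshev, empirical averages, Fubini with calculus, measurable derivatives. -/

section General

/-- A strict form of Chebyshev's inequality. -/
theorem measure_lt_lt_of_lintegral_sq_le {Ω : Type*} {mΩ : MeasurableSpace Ω} {μ : Measure Ω}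
    {X : Ω → ℝ} (hX : Measurable X) {q c : ℝ} (hq : 0 < q) (hc : 0 ≤ c)
    (h : ∫⁻ ω, ENNReal.ofReal (X ω ^ 2) ∂μ ≤ ENNReal.ofReal (q * c ^ 2)) :
    μ {ω | c < X ω} < ENNReal.ofReal q := by
  by_contra! hcon
  have hs : MeasurableSet {ω | c < X ω} := measurableSet_lt measurable_const hX
  have h0 : μ {ω | c < X ω} ≠ 0 := by
    intro h0
    rw [h0] at hcon
    simp at hcon
    linarith
  -- On a set of positive measure the pointwise inequality c² < X² integrates to a strict one; this
  -- is where strictness of the conclusion comes from.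
  have hlt : ∫⁻ _ in {ω | c < X ω}, ENNReal.ofReal (c ^ 2) ∂μ
      < ∫⁻ ω in {ω | c < X ω}, ENNReal.ofReal (X ω ^ 2) ∂μ := by
    refine setLIntegral_strict_mono hs h0 (by fun_prop) ?_ ?_
    · refine ((setLIntegral_mono (g := fun ω => ENNReal.ofReal (X ω ^ 2)) (by fun_prop) ?_).trans
        ((setLIntegral_le_lintegral _ _).trans h)).trans_lt ENNReal.ofReal_lt_top |>.ne
      intro ω hω
      have : c < X ω := hω
      exact ENNReal.ofReal_le_ofReal (by nlinarith)
    · refine ae_of_all _ fun ω hω => ?_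
      have : c < X ω := hω
      exact (ENNReal.ofReal_lt_ofReal_iff (by nlinarith)).2 (by nlinarith)
  rw [setLIntegral_const] at hlt
  have h2 := hlt.trans_le ((setLIntegral_le_lintegral _ _).trans h)
  rw [ENNReal.ofReal_mul hq.le, mul_comm] at h2
  exact absurd (h2.trans_le (mul_le_mul_left hcon _)) (lt_irrefl _)

/-- The mean square of a shifted, centred empirical average. -/
theorem lintegral_pi_norm_sq_add_average_sub_le {n M : ℕ} (hM : 0 < M) {Y : Type*}
    [MeasurableSpace Y] (μ : Measure Y) [IsProbabilityMeasure μ]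
    {f : Y → EuclideanSpace ℝ (Fin n)} (hf : MemLp f 2 μ) (e : EuclideanSpace ℝ (Fin n)) :
    ∫⁻ s, ENNReal.ofReal (‖e + ((M : ℝ)⁻¹ • ∑ j, f (s j) - ∫ y, f y ∂μ)‖ ^ 2)
        ∂(Measure.pi fun _ : Fin M => μ)
      ≤ ENNReal.ofReal (‖e‖ ^ 2 + (M : ℝ)⁻¹ * ∫ y, ‖f y‖ ^ 2 ∂μ) := by
  have hfi : ∀ i, MemLp (fun y => f y i) 2 μ := fun i =>
    (EuclideanSpace.proj i : EuclideanSpace ℝ (Fin n) →L[ℝ] ℝ).comp_memLp' hf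
  have hM' : (M : ℝ) ≠ 0 := by positivity
  set P := Measure.pi fun _ : Fin M => μ
  set m := ∫ y, f y ∂μ with hm
  have hmi : ∀ i, m i = ∫ y, f y i ∂μ := fun i =>
    ((EuclideanSpace.proj i : EuclideanSpace ℝ (Fin n) →L[ℝ] ℝ).integral_comp_comm
      (hf.integrable one_le_two)).symm
  have hcomp : ∀ i (j : Fin M), MemLp (fun s : Fin M → Y => f (s j) i) 2 P := fun i j =>
    (hfi i).comp_measurePreserving (measurePreserving_eval _ j)
  have hsum : ∀ i, MemLp (∑ j : Fin M, fun s : Fin M → Y => f (s j) i) 2 P := fun i =>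
    memLp_finsetSum' _ fun j _ => hcomp i j
  -- The squared norm is the sum of squared coordinates, so everything reduces to scalar variances:
  -- each coordinate has mean `e i`, and its square has mean `e i`² plus its variance.
  let X : Fin n → (Fin M → Y) → ℝ := fun i s =>
    (M : ℝ)⁻¹ * (∑ j : Fin M, fun s : Fin M → Y => f (s j) i) s + (e i - m i)
  have hX : ∀ i, MemLp (X i) 2 P := fun i => ((hsum i).const_mul _).add (memLp_const _)
  have hmean : ∀ i, ∫ s, X i s ∂P = e i := by
    intro i
    simp only [X]
    rw [integral_add (((hsum i).const_mul _).integrable one_le_two) (integrable_const _),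
      integral_const_mul]
    simp only [Finset.sum_apply]
    rw [integral_finsetSum _ fun j _ => (hcomp i j).integrable one_le_two]
    have : ∀ j : Fin M, ∫ s : Fin M → Y, f (s j) i ∂P = m i := fun j => by
      rw [hmi]
      exact integral_comp_eval (μ := fun _ : Fin M => μ) (i := j) (hfi i).aestronglyMeasurable
    simp only [this]
    simp
    field_simp
    ring
  have hvar : ∀ i, variance (X i) P ≤ (M : ℝ)⁻¹ * ∫ y, f y i ^ 2 ∂μ := by
    intro i
    simp only [X]
    -- The variance ignores the shift, scales by M⁻², and is additive over independent samples,
    -- leaving M⁻¹ times the variance of one sample.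
    rw [variance_add_const ((hsum i).const_mul _).aestronglyMeasurable, variance_const_mul,
      variance_sum_pi (μ := fun _ : Fin M => μ) (X := fun _ y => f y i) fun _ => hfi i]
    have := variance_le_expectation_sq (hfi i).aestronglyMeasurable
    simp only [Finset.sum_const, Finset.card_univ, Fintype.card_fin, nsmul_eq_mul]
    rw [pow_two, mul_assoc, inv_mul_cancel_left₀ hM']
    exact mul_le_mul_of_nonneg_left this (by positivity)
  have hsq : ∀ i, ∫ s, X i s ^ 2 ∂P ≤ e i ^ 2 + (M : ℝ)⁻¹ * ∫ y, f y i ^ 2 ∂μ := by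
    intro i
    have h1 := variance_eq_sub (hX i)
    have h2 := hvar i
    rw [h1, hmean] at h2
    simp only [Pi.pow_apply] at h2
    linarith
  have hnorm : ∀ s : Fin M → Y,
      ‖e + ((M : ℝ)⁻¹ • ∑ j, f (s j) - m)‖ ^ 2 = ∑ i, X i s ^ 2 := by
    intro s
    rw [EuclideanSpace.real_norm_sq_eq]
    refine Finset.sum_congr rfl fun i _ => ?_
    simp [X]
    ring
  simp_rw [hnorm]
  rw [← ofReal_integral_eq_lintegral_ofReal
    (integrable_finsetSum _ fun i _ => (hX i).integrable_sq)
    (ae_of_all _ fun s => Finset.sum_nonneg fun i _ => sq_nonneg _),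
    integral_finsetSum _ fun i _ => (hX i).integrable_sq]
  refine ENNReal.ofReal_le_ofReal ?_
  have h3 : ∫ y, ‖f y‖ ^ 2 ∂μ = ∑ i, ∫ y, f y i ^ 2 ∂μ := by
    simp_rw [EuclideanSpace.real_norm_sq_eq]
    exact integral_finsetSum _ fun i _ => (hfi i).integrable_sq
  rw [h3, EuclideanSpace.real_norm_sq_eq, Finset.mul_sum, ← Finset.sum_add_distrib]
  exact Finset.sum_le_sum fun i _ => hsq i

/-- The fundamental theorem of calculus on `[0, 1]`, integrated over a parameter. -/
theorem integral_sub_integral_eq_of_hasDerivAt {Z E : Type*} [MeasurableSpace Z]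
    [NormedAddCommGroup E] [NormedSpace ℝ E] [CompleteSpace E] (ν : Measure Z) [SigmaFinite ν]
    {φ φ' : ℝ → Z → E} (hcont : ∀ z, ContinuousOn (fun a => φ a z) (Icc 0 1))
    (hderiv : ∀ z, ∀ a ∈ Ioo (0 : ℝ) 1, HasDerivAt (fun a => φ a z) (φ' a z) a)
    (hcont' : ∀ z, ContinuousOn (fun a => φ' a z) (Icc 0 1))
    (hint : Integrable (Function.uncurry φ') ((volume.restrict (Icc (0 : ℝ) 1)).prod ν))
    (h0 : Integrable (φ 0) ν) (h1 : Integrable (φ 1) ν) :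
    ∫ z, φ 1 z ∂ν - ∫ z, φ 0 z ∂ν
      = ∫ az, φ' az.1 az.2 ∂((volume.restrict (Icc (0 : ℝ) 1)).prod ν) := by
  rw [integral_prod_symm (fun az : ℝ × Z => φ' az.1 az.2) hint, ← integral_sub h1 h0]
  refine integral_congr_ae (ae_of_all _ fun z => ?_)
  simp only
  rw [integral_Icc_eq_integral_Ioc, ← intervalIntegral.integral_of_le zero_le_one]
  refine (intervalIntegral.integral_eq_sub_of_hasDerivAt_of_le zero_le_one (hcont z)
    (hderiv z) ?_).symm
  exact ContinuousOn.intervalIntegrable (by simpa using hcont' z)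

/-- `fderivWithin` is measurable in a parameter, in finite dimension. -/
theorem stronglyMeasurable_fderivWithin_of_segment {n : ℕ} {Z E : Type*} [MeasurableSpace Z]
    [NormedAddCommGroup E] [NormedSpace ℝ E]
    {K : Set (EuclideanSpace ℝ (Fin n))} {f : EuclideanSpace ℝ (Fin n) → Z → E}
    (hf : ∀ x ∈ K, StronglyMeasurable (f x)) {x : EuclideanSpace ℝ (Fin n)} (hx : x ∈ K)
    (hd : ∀ z, DifferentiableWithinAt ℝ (fun y => f y z) K x)
    (hseg : ∀ i, ∃ c : ℝ, c ≠ 0 ∧ ∀ k ∈ Icc (0 : ℝ) 1,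
      x + k • (c • EuclideanSpace.single i (1 : ℝ)) ∈ K) :
    StronglyMeasurable (fun z => fderivWithin ℝ (fun y => f y z) K x) := by
  have key : ∀ i, StronglyMeasurable (fun z => fderivWithin ℝ (fun y => f y z) K x
      (EuclideanSpace.single i (1 : ℝ))) := by
    intro i
    obtain ⟨c, hc, hk⟩ := hseg i
    set w := c • EuclideanSpace.single i (1 : ℝ)
    -- Along a segment inside `K`, the directional derivative is a pointwise limit of difference
    -- quotients, each measurable in `z`.
    have hw : StronglyMeasurable (fun z => fderivWithin ℝ (fun y => f y z) K x w) := by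
      refine stronglyMeasurable_of_tendsto atTop
        (f := fun (N : ℕ) z => ((N : ℝ) + 1) • (f (x + ((N : ℝ) + 1)⁻¹ • w) z - f x z)) ?_ ?_
      · intro N
        refine StronglyMeasurable.const_smul ((hf _ (hk _ ⟨by positivity, ?_⟩)).sub (hf _ hx)) _
        exact inv_le_one_of_one_le₀ (by linarith [(Nat.cast_nonneg N : (0:ℝ) ≤ N)])
      · rw [tendsto_pi_nhds]
        intro z
        refine HasFDerivWithinAt.lim (c := fun N : ℕ => (N : ℝ) + 1)
          (d := fun N : ℕ => ((N : ℝ) + 1)⁻¹ • w) (hd z).hasFDerivWithinAt ?_ ?_ ?_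
        · rw [← zero_smul ℝ w]
          refine Tendsto.smul_const ?_ w
          exact tendsto_inv_atTop_zero.comp
            (tendsto_atTop_add_const_right _ _ tendsto_natCast_atTop_atTop)
        · refine Eventually.of_forall fun N => hk _ ⟨by positivity, ?_⟩
          exact inv_le_one_of_one_le₀ (by linarith [(Nat.cast_nonneg N : (0:ℝ) ≤ N)])
        · refine tendsto_const_nhds.congr fun N => ?_
          rw [smul_inv_smul₀]
          positivity
    have hcw : (fun z => fderivWithin ℝ (fun y => f y z) K x (EuclideanSpace.single i (1 : ℝ)))
        = fun z => c⁻¹ • fderivWithin ℝ (fun y => f y z) K x w := by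
      funext z
      rw [← map_smul, inv_smul_smul₀ hc]
    rw [hcw]
    exact hw.const_smul c⁻¹
  -- A linear map is determined by its values on the basis, through finitely many continuous
  -- operations.
  have hrep : ∀ A : EuclideanSpace ℝ (Fin n) →L[ℝ] E, A = ∑ i,
      ContinuousLinearMap.smulRightL ℝ (EuclideanSpace ℝ (Fin n)) E
        (EuclideanSpace.proj i : EuclideanSpace ℝ (Fin n) →L[ℝ] ℝ)
        (A (EuclideanSpace.single i (1 : ℝ))) := by
    intro A
    ext w
    simp only [sum_apply, ContinuousLinearMap.smulRightL_apply_apply,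
      ContinuousLinearMap.smulRight_apply, PiLp.proj_apply]
    conv_lhs => rw [← (EuclideanSpace.basisFun (Fin n) ℝ).sum_repr w]
    simp
  have : (fun z => fderivWithin ℝ (fun y => f y z) K x) = fun z => ∑ i,
      ContinuousLinearMap.smulRightL ℝ (EuclideanSpace ℝ (Fin n)) E
        (EuclideanSpace.proj i : EuclideanSpace ℝ (Fin n) →L[ℝ] ℝ)
        (fderivWithin ℝ (fun y => f y z) K x (EuclideanSpace.single i (1 : ℝ))) :=
    funext fun z => hrep _
  rw [this]
  exact Finset.stronglyMeasurable_fun_sum _ fun i _ =>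
    (ContinuousLinearMap.continuous _).comp_stronglyMeasurable (key i)

/-- The operator turning a linear form into the vector that represents it. -/
noncomputable def formToVec (n : ℕ) :
    (EuclideanSpace ℝ (Fin n) →L[ℝ] ℝ) →L[ℝ] EuclideanSpace ℝ (Fin n) :=
  ∑ i, (ContinuousLinearMap.apply ℝ ℝ (EuclideanSpace.single i (1 : ℝ))).smulRight
    (EuclideanSpace.single i (1 : ℝ))

/-- Expressing the gradient as a fixed continuous linear image of the derivative lets smoothness and
measurability pass from one to the other. -/
theorem gradientWithin_eq_formToVec {n : ℕ} (f : EuclideanSpace ℝ (Fin n) → ℝ)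
    (K : Set (EuclideanSpace ℝ (Fin n))) (x : EuclideanSpace ℝ (Fin n)) :
    gradientWithin f K x = formToVec n (fderivWithin ℝ f K x) := by
  ext i
  have h : ⟪gradientWithin f K x, EuclideanSpace.single i (1 : ℝ)⟫_ℝ
      = fderivWithin ℝ f K x (EuclideanSpace.single i (1 : ℝ)) := by
    rw [← toDual_gradientWithin, InnerProductSpace.toDual_apply_apply]
  rw [EuclideanSpace.inner_single_right] at h
  simpa [formToVec, Pi.single_apply] using h

theorem fderivWithin_eq_inner_gradientWithin {n : ℕ} (f : EuclideanSpace ℝ (Fin n) → ℝ)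
    (K : Set (EuclideanSpace ℝ (Fin n))) (x h : EuclideanSpace ℝ (Fin n)) :
    fderivWithin ℝ f K x h = ⟪gradientWithin f K x, h⟫_ℝ := by
  rw [← toDual_gradientWithin, InnerProductSpace.toDual_apply_apply]

end General

section Outer

variable {E : Type*} [NormedAddCommGroup E] [InnerProductSpace ℝ E]

theorem continuous_innerSL_smulRight :
    Continuous fun q : E × E => (innerSL ℝ q.1).smulRight q.2 := by
  have : Continuous fun q : E × E =>
      ContinuousLinearMap.smulRightL ℝ E E (innerSL ℝ q.1) q.2 := by fun_prop
  exact this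

theorem continuousOn_innerSL_smulRight {X : Type*} [TopologicalSpace X] {s : Set X} {f g : X → E}
    (hf : ContinuousOn f s) (hg : ContinuousOn g s) :
    ContinuousOn (fun x => (innerSL ℝ (f x)).smulRight (g x)) s :=
  continuous_innerSL_smulRight.comp_continuousOn (hf.prodMk hg)

theorem stronglyMeasurable_innerSL_smulRight {X : Type*} [MeasurableSpace X] {f g : X → E}
    (hf : StronglyMeasurable f) (hg : StronglyMeasurable g) :
    StronglyMeasurable (fun x => (innerSL ℝ (f x)).smulRight (g x)) :=
  continuous_innerSL_smulRight.comp_stronglyMeasurable (hf.prodMk hg)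

end Outer

namespace StochProblem

/-! ### The geometry of the box and calculus relative to it. -/

section Box

variable {n : ℕ} {Z : Type*} [MeasurableSpace Z] {Q : StochProblem n Z}

theorem convex_box : Convex ℝ Q.box := by
  intro x hx y hy a b ha hb hab i
  simp only [PiLp.add_apply, PiLp.smul_apply, smul_eq_mul]
  obtain ⟨h1, h2⟩ := hx i
  obtain ⟨h3, h4⟩ := hy i
  refine ⟨by positivity, ?_⟩
  have : a * x i + b * y i ≤ a * Q.u i + b * Q.u i := by gcongr
  rwa [← add_mul, hab, one_mul] at this

theorem uniqueDiffOn_box (hu : ∀ i, 0 < Q.u i) : UniqueDiffOn ℝ Q.box := by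
  refine uniqueDiffOn_convex convex_box ?_
  have hopen : IsOpen {x : EuclideanSpace ℝ (Fin n) | ∀ i, 0 < x i ∧ x i < Q.u i} := by
    simp only [ofPred_forall]
    refine isOpen_iInter_of_finite fun i => ?_
    have hi : Continuous fun x : EuclideanSpace ℝ (Fin n) => x i := by fun_prop
    exact (isOpen_lt continuous_const hi).inter (isOpen_lt hi continuous_const)
  refine ⟨WithLp.toLp 2 fun i => Q.u i / 2, ?_⟩
  refine interior_maximal (fun x hx i => ⟨(hx i).1.le, (hx i).2.le⟩) hopen ?_
  intro i
  have := hu i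
  exact ⟨by simpa using by linarith, by simpa using by linarith⟩

theorem zero_mem_box (hu : ∀ i, 0 < Q.u i) : (0 : EuclideanSpace ℝ (Fin n)) ∈ Q.box :=
  fun i => ⟨by simp, by simpa using (hu i).le⟩

/-- The coordinatewise retraction onto the box. -/
noncomputable def clamp (Q : StochProblem n Z) (x : EuclideanSpace ℝ (Fin n)) :
    EuclideanSpace ℝ (Fin n) :=
  WithLp.toLp 2 fun i => max 0 (min (x i) (Q.u i))

theorem continuous_clamp : Continuous Q.clamp := by
  unfold clamp
  fun_prop

theorem clamp_mem (hu : ∀ i, 0 < Q.u i) (x : EuclideanSpace ℝ (Fin n)) : Q.clamp x ∈ Q.box :=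
  fun i => ⟨by simp [clamp], by simpa [clamp] using (hu i).le⟩

theorem clamp_eq_self {x : EuclideanSpace ℝ (Fin n)} (hx : x ∈ Q.box) : Q.clamp x = x := by
  ext i
  simp [clamp, (hx i).1, (hx i).2]

/-- The point `a x + (1 - a) y`. -/
def segPoint (x y : EuclideanSpace ℝ (Fin n)) (a : ℝ) : EuclideanSpace ℝ (Fin n) :=
  a • x + (1 - a) • y

theorem segPoint_mem {x y : EuclideanSpace ℝ (Fin n)} (hx : x ∈ Q.box) (hy : y ∈ Q.box) {a : ℝ}
    (ha : a ∈ Icc (0 : ℝ) 1) : segPoint x y a ∈ Q.box :=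
  convex_box hx hy ha.1 (sub_nonneg.2 ha.2) (by ring)

@[fun_prop]
theorem continuous_segPoint (x y : EuclideanSpace ℝ (Fin n)) : Continuous (segPoint x y) := by
  unfold segPoint
  fun_prop

@[simp] theorem segPoint_zero (x y : EuclideanSpace ℝ (Fin n)) : segPoint x y 0 = y := by
  simp [segPoint]

@[simp] theorem segPoint_one (x y : EuclideanSpace ℝ (Fin n)) : segPoint x y 1 = x := by
  simp [segPoint]

theorem segPoint_sub (x y : EuclideanSpace ℝ (Fin n)) (a : ℝ) :
    segPoint x y a - y = a • (x - y) := by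
  simp only [segPoint]
  module

/-- At an interior parameter both nearby sides of the segment stay in the box, so a derivative
relative to the box yields a two-sided one, even when the segment lies on the boundary. -/
theorem hasDerivAt_comp_segPoint {E : Type*} [NormedAddCommGroup E] [NormedSpace ℝ E]
    {f : EuclideanSpace ℝ (Fin n) → E} {f' : EuclideanSpace ℝ (Fin n) →L[ℝ] E}
    {x y : EuclideanSpace ℝ (Fin n)} (hx : x ∈ Q.box) (hy : y ∈ Q.box) {a : ℝ}
    (ha : a ∈ Ioo (0 : ℝ) 1) (hf : HasFDerivWithinAt f f' Q.box (segPoint x y a)) :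
    HasDerivAt (fun b => f (segPoint x y b)) (f' (x - y)) a := by
  have h1 : HasDerivAt (segPoint x y) (x - y) a := by
    unfold segPoint
    have := ((hasDerivAt_id a).smul_const x).add
      (((hasDerivAt_const a (1 : ℝ)).sub (hasDerivAt_id a)).smul_const y)
    convert! this using 1
    module
  have h2 := hf.comp_hasDerivWithinAt (s := Icc 0 1) a h1.hasDerivWithinAt
    fun b hb => segPoint_mem hx hy hb
  exact h2.hasDerivAt (Icc_mem_nhds ha.1 ha.2)

theorem continuousOn_comp_segPoint {E : Type*} [TopologicalSpace E]
    {f : EuclideanSpace ℝ (Fin n) → E} {x y : EuclideanSpace ℝ (Fin n)} (hx : x ∈ Q.box)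
    (hy : y ∈ Q.box) (hf : ContinuousOn f Q.box) :
    ContinuousOn (fun b => f (segPoint x y b)) (Icc 0 1) :=
  hf.comp (continuous_segPoint x y).continuousOn fun _ hb => segPoint_mem hx hy hb

/-- Each coordinate has room u_i/2 upwards or downwards, whichever half it lies in. This supplies
one-sided difference quotients at boundary points. -/
theorem exists_segment_mem_box (hu : ∀ i, 0 < Q.u i) {x : EuclideanSpace ℝ (Fin n)}
    (hx : x ∈ Q.box) (i : Fin n) : ∃ c : ℝ, c ≠ 0 ∧ ∀ k ∈ Icc (0 : ℝ) 1,
      x + k • (c • EuclideanSpace.single i (1 : ℝ)) ∈ Q.box := by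
  have hui := hu i
  rcases le_total (x i) (Q.u i / 2) with h | h
  · refine ⟨Q.u i / 2, by positivity, fun k hk j => ?_⟩
    rcases eq_or_ne j i with rfl | hj
    · have := hx j
      simp only [PiLp.add_apply, PiLp.smul_apply, PiLp.single_apply, smul_eq_mul,
        if_true, mul_one]
      constructor <;> nlinarith [hk.1, hk.2]
    · simpa [hj] using hx j
  · refine ⟨-(Q.u i / 2), by linarith, fun k hk j => ?_⟩
    rcases eq_or_ne j i with rfl | hj
    · have := hx j
      simp only [PiLp.add_apply, PiLp.smul_apply, PiLp.single_apply, smul_eq_mul,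
        if_true, mul_one]
      constructor <;> nlinarith [hk.1, hk.2]
    · simpa [hj] using hx j

theorem contDiffOn_gradientWithin_box (hu : ∀ i, 0 < Q.u i) {f : EuclideanSpace ℝ (Fin n) → ℝ}
    (hf : ContDiffOn ℝ 2 f Q.box) : ContDiffOn ℝ 1 (gradientWithin f Q.box) Q.box := by
  have : gradientWithin f Q.box = fun x => formToVec n (fderivWithin ℝ f Q.box x) :=
    funext fun x => gradientWithin_eq_formToVec f Q.box x
  rw [this]
  exact (formToVec n).contDiff.comp_contDiffOn
    (hf.fderivWithin (uniqueDiffOn_box hu) (by norm_num))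

theorem continuousOn_fderivWithin_gradientWithin_box (hu : ∀ i, 0 < Q.u i)
    {f : EuclideanSpace ℝ (Fin n) → ℝ} (hf : ContDiffOn ℝ 2 f Q.box) :
    ContinuousOn (fderivWithin ℝ (gradientWithin f Q.box) Q.box) Q.box :=
  (contDiffOn_gradientWithin_box hu hf).continuousOn_fderivWithin (uniqueDiffOn_box hu) le_rfl

theorem stronglyMeasurable_gradientWithin_box (hu : ∀ i, 0 < Q.u i)
    {f : EuclideanSpace ℝ (Fin n) → Z → ℝ} (hf : ∀ z, ContDiffOn ℝ 2 (fun x => f x z) Q.box)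
    (hm : ∀ x ∈ Q.box, Measurable (f x)) {x : EuclideanSpace ℝ (Fin n)} (hx : x ∈ Q.box) :
    StronglyMeasurable fun z => gradientWithin (fun y => f y z) Q.box x := by
  simp_rw [gradientWithin_eq_formToVec]
  refine (formToVec n).continuous.comp_stronglyMeasurable ?_
  exact stronglyMeasurable_fderivWithin_of_segment (fun y hy => (hm y hy).stronglyMeasurable) hx
    (fun z => (hf z).differentiableOn (by norm_num) x hx) (exists_segment_mem_box hu hx)

theorem stronglyMeasurable_fderivWithin_gradientWithin_box (hu : ∀ i, 0 < Q.u i)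
    {f : EuclideanSpace ℝ (Fin n) → Z → ℝ} (hf : ∀ z, ContDiffOn ℝ 2 (fun x => f x z) Q.box)
    (hm : ∀ x ∈ Q.box, Measurable (f x)) {x : EuclideanSpace ℝ (Fin n)} (hx : x ∈ Q.box) :
    StronglyMeasurable fun z =>
      fderivWithin ℝ (gradientWithin (fun y => f y z) Q.box) Q.box x :=
  stronglyMeasurable_fderivWithin_of_segment
    (f := fun x z => gradientWithin (fun y => f y z) Q.box x)
    (fun _ hy => stronglyMeasurable_gradientWithin_box hu hf hm hy) hx
    (fun z => (contDiffOn_gradientWithin_box hu (hf z)).differentiableOn (by norm_num) x hx)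
    (exists_segment_mem_box hu hx)

/-- Functions continuous on the box and measurable in the parameter are jointly measurable. -/
theorem stronglyMeasurable_uncurry_clamp (hu : ∀ i, 0 < Q.u i) {E : Type*} [TopologicalSpace E]
    [TopologicalSpace.PseudoMetrizableSpace E] {f : EuclideanSpace ℝ (Fin n) → Z → E}
    (hc : ∀ z, ContinuousOn (fun x => f x z) Q.box)
    (hm : ∀ x ∈ Q.box, StronglyMeasurable (f x)) :
    StronglyMeasurable fun q : EuclideanSpace ℝ (Fin n) × Z => f (Q.clamp q.1) q.2 :=
  stronglyMeasurable_uncurry_of_continuous_of_stronglyMeasurable (u := fun x z => f (Q.clamp x) z)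
    (fun z => (hc z).comp_continuous continuous_clamp (clamp_mem hu))
    fun x => hm _ (clamp_mem hu x)

end Box

/-! ### Regularity of the estimators and the score-function identities. -/

namespace Assumptions

variable {n : ℕ} {Z : Type*} [MeasurableSpace Z] {Q : StochProblem n Z}
  {D B GF LF Gp Lp L2F L2p : ℝ}

theorem contDiffOn_gradFt (hQ : Q.Assumptions D B GF LF Gp Lp L2F L2p) (z : Z) :
    ContDiffOn ℝ 1 (fun x => Q.gradFt x z) Q.box :=
  contDiffOn_gradientWithin_box hQ.u_pos (hQ.Ft_smooth z)

theorem contDiffOn_gradLogp (hQ : Q.Assumptions D B GF LF Gp Lp L2F L2p) (z : Z) :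
    ContDiffOn ℝ 1 (fun x => Q.gradLogp x z) Q.box :=
  contDiffOn_gradientWithin_box hQ.u_pos (hQ.logp_smooth z)

theorem continuousOn_hessFt (hQ : Q.Assumptions D B GF LF Gp Lp L2F L2p) (z : Z) :
    ContinuousOn (fun x => Q.hessFt x z) Q.box :=
  continuousOn_fderivWithin_gradientWithin_box hQ.u_pos (hQ.Ft_smooth z)

theorem continuousOn_hessLogp (hQ : Q.Assumptions D B GF LF Gp Lp L2F L2p) (z : Z) :
    ContinuousOn (fun x => Q.hessLogp x z) Q.box :=
  continuousOn_fderivWithin_gradientWithin_box hQ.u_pos (hQ.logp_smooth z)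

theorem measurable_gradFt (hQ : Q.Assumptions D B GF LF Gp Lp L2F L2p)
    {x : EuclideanSpace ℝ (Fin n)} (hx : x ∈ Q.box) : StronglyMeasurable (Q.gradFt x) :=
  stronglyMeasurable_gradientWithin_box hQ.u_pos hQ.Ft_smooth hQ.Ft_measurable hx

theorem measurable_gradLogp (hQ : Q.Assumptions D B GF LF Gp Lp L2F L2p)
    {x : EuclideanSpace ℝ (Fin n)} (hx : x ∈ Q.box) : StronglyMeasurable (Q.gradLogp x) :=
  stronglyMeasurable_gradientWithin_box (f := fun x z => Real.log (Q.p x z)) hQ.u_pos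
    hQ.logp_smooth (fun x hx => (hQ.p_measurable x hx).log) hx

theorem measurable_hessFt (hQ : Q.Assumptions D B GF LF Gp Lp L2F L2p)
    {x : EuclideanSpace ℝ (Fin n)} (hx : x ∈ Q.box) : StronglyMeasurable (Q.hessFt x) :=
  stronglyMeasurable_fderivWithin_gradientWithin_box hQ.u_pos hQ.Ft_smooth hQ.Ft_measurable hx

theorem measurable_hessLogp (hQ : Q.Assumptions D B GF LF Gp Lp L2F L2p)
    {x : EuclideanSpace ℝ (Fin n)} (hx : x ∈ Q.box) : StronglyMeasurable (Q.hessLogp x) :=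
  stronglyMeasurable_fderivWithin_gradientWithin_box (f := fun x z => Real.log (Q.p x z)) hQ.u_pos
    hQ.logp_smooth (fun x hx => (hQ.p_measurable x hx).log) hx

theorem continuousOn_p (hQ : Q.Assumptions D B GF LF Gp Lp L2F L2p) (z : Z) :
    ContinuousOn (fun x => Q.p x z) Q.box :=
  ((hQ.logp_smooth z).continuousOn.rexp).congr fun x hx => (Real.exp_log (hQ.p_pos x hx z)).symm

theorem continuousOn_gradEst (hQ : Q.Assumptions D B GF LF Gp Lp L2F L2p) (z : Z) :
    ContinuousOn (fun x => Q.gradEst x z) Q.box :=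
  (hQ.contDiffOn_gradFt z).continuousOn.add
    ((hQ.Ft_smooth z).continuousOn.smul (hQ.contDiffOn_gradLogp z).continuousOn)

theorem measurable_gradEst (hQ : Q.Assumptions D B GF LF Gp Lp L2F L2p)
    {x : EuclideanSpace ℝ (Fin n)} (hx : x ∈ Q.box) : StronglyMeasurable (Q.gradEst x) :=
  (hQ.measurable_gradFt hx).add
    ((hQ.Ft_measurable x hx).stronglyMeasurable.smul (hQ.measurable_gradLogp hx))

theorem continuousOn_hessEst (hQ : Q.Assumptions D B GF LF Gp Lp L2F L2p) (z : Z) :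
    ContinuousOn (fun x => Q.hessEst x z) Q.box := by
  have hF := (hQ.contDiffOn_gradFt z).continuousOn
  have hP := (hQ.contDiffOn_gradLogp z).continuousOn
  have h1 := continuousOn_innerSL_smulRight hP hF
  have h2 := continuousOn_innerSL_smulRight hF hP
  have h3 := continuousOn_innerSL_smulRight hP hP
  have h4 := (hQ.continuousOn_hessLogp z).add h3
  have h5 := (hQ.Ft_smooth z).continuousOn.smul h4
  have h6 := ((hQ.continuousOn_hessFt z).add h1).add h2
  exact h6.add h5

theorem measurable_hessEst (hQ : Q.Assumptions D B GF LF Gp Lp L2F L2p)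
    {x : EuclideanSpace ℝ (Fin n)} (hx : x ∈ Q.box) : StronglyMeasurable (Q.hessEst x) := by
  have hF := hQ.measurable_gradFt hx
  have hP := hQ.measurable_gradLogp hx
  have h1 := stronglyMeasurable_innerSL_smulRight hP hF
  have h2 := stronglyMeasurable_innerSL_smulRight hF hP
  have h3 := stronglyMeasurable_innerSL_smulRight hP hP
  have h4 := (hQ.measurable_hessLogp hx).add h3
  have h5 := (hQ.Ft_measurable x hx).stronglyMeasurable.smul h4
  have h6 := ((hQ.measurable_hessFt hx).add h1).add h2
  exact h6.add h5

/-- Smoothness is assumed for log p only; p is its exponential, which gives ∇p = p ∇log p. -/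
theorem hasFDerivWithinAt_p (hQ : Q.Assumptions D B GF LF Gp Lp L2F L2p)
    {x : EuclideanSpace ℝ (Fin n)} (hx : x ∈ Q.box) (z : Z) :
    HasFDerivWithinAt (fun y => Q.p y z) (Q.p x z • innerSL ℝ (Q.gradLogp x z)) Q.box x := by
  have h := ((hQ.logp_smooth z).differentiableOn (by norm_num) x hx).hasFDerivWithinAt.exp
  rw [Real.exp_log (hQ.p_pos x hx z)] at h
  have h2 := h.congr (fun y hy => (Real.exp_log (hQ.p_pos y hy z)).symm)
    (Real.exp_log (hQ.p_pos x hx z)).symm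
  convert! h2 using 2
  ext v
  exact (fderivWithin_eq_inner_gradientWithin _ _ _ _).symm

theorem hasFDerivWithinAt_Ft (hQ : Q.Assumptions D B GF LF Gp Lp L2F L2p)
    {x : EuclideanSpace ℝ (Fin n)} (hx : x ∈ Q.box) (z : Z) :
    HasFDerivWithinAt (fun y => Q.Ft y z) (innerSL ℝ (Q.gradFt x z)) Q.box x := by
  convert! ((hQ.Ft_smooth z).differentiableOn (by norm_num) x hx).hasFDerivWithinAt using 1
  ext v
  exact (fderivWithin_eq_inner_gradientWithin _ _ _ _).symm

theorem hasFDerivWithinAt_gradFt (hQ : Q.Assumptions D B GF LF Gp Lp L2F L2p)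
    {x : EuclideanSpace ℝ (Fin n)} (hx : x ∈ Q.box) (z : Z) :
    HasFDerivWithinAt (fun y => Q.gradFt y z) (Q.hessFt x z) Q.box x :=
  ((hQ.contDiffOn_gradFt z).differentiableOn (by norm_num) x hx).hasFDerivWithinAt

theorem hasFDerivWithinAt_gradLogp (hQ : Q.Assumptions D B GF LF Gp Lp L2F L2p)
    {x : EuclideanSpace ℝ (Fin n)} (hx : x ∈ Q.box) (z : Z) :
    HasFDerivWithinAt (fun y => Q.gradLogp y z) (Q.hessLogp x z) Q.box x :=
  ((hQ.contDiffOn_gradLogp z).differentiableOn (by norm_num) x hx).hasFDerivWithinAt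

/-- The score-function identity for the objective, before integration. -/
theorem hasFDerivWithinAt_p_smul_Ft (hQ : Q.Assumptions D B GF LF Gp Lp L2F L2p)
    {x : EuclideanSpace ℝ (Fin n)} (hx : x ∈ Q.box) (z : Z) :
    HasFDerivWithinAt (fun y => Q.p y z • Q.Ft y z)
      (Q.p x z • innerSL ℝ (Q.gradEst x z)) Q.box x := by
  convert! (hQ.hasFDerivWithinAt_p hx z).smul (hQ.hasFDerivWithinAt_Ft hx z) using 1
  ext v
  simp [gradEst]
  ring

/-- The score-function identity for the gradient, before integration. -/
theorem hasFDerivWithinAt_p_smul_gradEst (hQ : Q.Assumptions D B GF LF Gp Lp L2F L2p)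
    {x : EuclideanSpace ℝ (Fin n)} (hx : x ∈ Q.box) (z : Z) :
    HasFDerivWithinAt (fun y => Q.p y z • Q.gradEst y z)
      (Q.p x z • Q.hessEst x z) Q.box x := by
  have h := (hQ.hasFDerivWithinAt_p hx z).smul ((hQ.hasFDerivWithinAt_gradFt hx z).add
    ((hQ.hasFDerivWithinAt_Ft hx z).smul (hQ.hasFDerivWithinAt_gradLogp hx z)))
  convert! h using 1
  ext1 v
  simp [hessEst]
  module

end Assumptions

end StochProblem

/-! ### Moment bounds under the sampling law. -/

section Moments

variable {Ω : Type*} {mΩ : MeasurableSpace Ω} {μ : Measure Ω}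

theorem integrable_and_integral_le_of_lintegral_ofReal_le {f : Ω → ℝ} (hf : AEStronglyMeasurable f μ)
    (h0 : ∀ ω, 0 ≤ f ω) {c : ℝ} (hc : 0 ≤ c)
    (h : ∫⁻ ω, ENNReal.ofReal (f ω) ∂μ ≤ ENNReal.ofReal c) : Integrable f μ ∧ ∫ ω, f ω ∂μ ≤ c := by
  refine ⟨⟨hf, ?_⟩, ?_⟩
  · rw [hasFiniteIntegral_iff_ofReal (ae_of_all _ h0)]
    exact h.trans_lt ENNReal.ofReal_lt_top
  · rw [integral_eq_lintegral_of_nonneg_ae (ae_of_all _ h0) hf]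
    exact ENNReal.toReal_le_of_le_ofReal hc h

/-- Nonnegativity of the variance gives (E X)² ≤ E X². -/
theorem integrable_and_integral_le_of_integral_sq_le [IsProbabilityMeasure μ] {X : Ω → ℝ}
    (hX : AEStronglyMeasurable X μ) (h0 : ∀ ω, 0 ≤ X ω) {c : ℝ} (hc : 0 ≤ c)
    (hi : Integrable (fun ω => X ω ^ 2) μ) (h : ∫ ω, X ω ^ 2 ∂μ ≤ c ^ 2) :
    Integrable X μ ∧ ∫ ω, X ω ∂μ ≤ c := by
  have hL : MemLp X 2 μ := (memLp_two_iff_integrable_sq hX).2 hi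
  refine ⟨hL.integrable one_le_two, ?_⟩
  have h1 := variance_eq_sub hL
  have h2 := variance_nonneg X μ
  simp only [Pi.pow_apply] at h1
  have h3 : 0 ≤ ∫ ω, X ω ∂μ := integral_nonneg h0
  exact abs_le_of_sq_le_sq' (by linarith) hc |>.2

end Moments

namespace StochProblem

namespace Assumptions

variable {n : ℕ} {Z : Type*} [MeasurableSpace Z] {Q : StochProblem n Z}
  {D B GF LF Gp Lp L2F L2p : ℝ}

section SampleLaw

/-- A probability measure forces `Z` to be nonempty, so the bounds are bounds on actual absolute
values and norms. -/
theorem bounds_nonneg (hQ : Q.Assumptions D B GF LF Gp Lp L2F L2p) : 0 ≤ B ∧ 0 ≤ GF ∧ 0 ≤ LF := by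
  have h0 := zero_mem_box hQ.u_pos
  have := hQ.p_prob 0 h0
  obtain ⟨z⟩ : Nonempty Z := nonempty_of_isProbabilityMeasure (Q.sampleLaw 0)
  exact ⟨(abs_nonneg _).trans (hQ.Ft_bound 0 h0 z), (norm_nonneg _).trans (hQ.gradFt_bound 0 h0 z),
    (norm_nonneg _).trans (hQ.hessFt_bound 0 h0 z)⟩

/-- The second and first moments follow from the fourth by applying the variance inequality twice.
-/
theorem gradLogp_moments (hQ : Q.Assumptions D B GF LF Gp Lp L2F L2p)
    {x : EuclideanSpace ℝ (Fin n)} (hx : x ∈ Q.box) :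
    (Integrable (fun z => ‖Q.gradLogp x z‖ ^ 4) (Q.sampleLaw x) ∧
      ∫ z, ‖Q.gradLogp x z‖ ^ 4 ∂Q.sampleLaw x ≤ Gp ^ 4) ∧
    (Integrable (fun z => ‖Q.gradLogp x z‖ ^ 2) (Q.sampleLaw x) ∧
      ∫ z, ‖Q.gradLogp x z‖ ^ 2 ∂Q.sampleLaw x ≤ Gp ^ 2) ∧
    (Integrable (fun z => ‖Q.gradLogp x z‖) (Q.sampleLaw x) ∧
      ∫ z, ‖Q.gradLogp x z‖ ∂Q.sampleLaw x ≤ Gp) := by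
  have := hQ.p_prob x hx
  have hm : AEStronglyMeasurable (fun z => ‖Q.gradLogp x z‖) (Q.sampleLaw x) :=
    (hQ.measurable_gradLogp hx).norm.aestronglyMeasurable
  have hG := hQ.Gp_nonneg
  have h4 := integrable_and_integral_le_of_lintegral_ofReal_le
    (f := fun z => ‖Q.gradLogp x z‖ ^ 4) (hm.pow 4)
    (fun z => by positivity) (by positivity) (hQ.gradLogp_bound x hx)
  have h2 := integrable_and_integral_le_of_integral_sq_le (X := fun z => ‖Q.gradLogp x z‖ ^ 2)
    (c := Gp ^ 2) (hm.pow 2) (fun z => by positivity) (by positivity)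
    (by simpa only [← pow_mul] using h4.1) (by simpa only [← pow_mul] using h4.2)
  exact ⟨h4, h2, integrable_and_integral_le_of_integral_sq_le hm (fun z => norm_nonneg _) hG
    h2.1 h2.2⟩

theorem hessLogp_moment (hQ : Q.Assumptions D B GF LF Gp Lp L2F L2p)
    {x : EuclideanSpace ℝ (Fin n)} (hx : x ∈ Q.box) :
    Integrable (fun z => ‖Q.hessLogp x z‖ ^ 2) (Q.sampleLaw x) ∧
      ∫ z, ‖Q.hessLogp x z‖ ^ 2 ∂Q.sampleLaw x ≤ Lp ^ 2 :=
  integrable_and_integral_le_of_lintegral_ofReal_le (f := fun z => ‖Q.hessLogp x z‖ ^ 2)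
    ((hQ.measurable_hessLogp hx).norm.aestronglyMeasurable.pow 2)
    (fun z => by positivity) (by positivity) (hQ.hessLogp_bound x hx)

theorem norm_gradEst_le (hQ : Q.Assumptions D B GF LF Gp Lp L2F L2p)
    {x : EuclideanSpace ℝ (Fin n)} (hx : x ∈ Q.box) (z : Z) :
    ‖Q.gradEst x z‖ ≤ GF + B * ‖Q.gradLogp x z‖ := by
  refine (norm_add_le _ _).trans (add_le_add (hQ.gradFt_bound x hx z) ?_)
  rw [norm_smul]
  exact mul_le_mul_of_nonneg_right (hQ.Ft_bound x hx z) (norm_nonneg _)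

theorem norm_hessEst_le (hQ : Q.Assumptions D B GF LF Gp Lp L2F L2p)
    {x : EuclideanSpace ℝ (Fin n)} (hx : x ∈ Q.box) (z : Z) :
    ‖Q.hessEst x z‖ ≤ LF + 2 * GF * ‖Q.gradLogp x z‖ + B * ‖Q.hessLogp x z‖
      + B * ‖Q.gradLogp x z‖ ^ 2 := by
  have hF := hQ.gradFt_bound x hx z
  have hB := hQ.Ft_bound x hx z
  have h1 : ‖(innerSL ℝ (Q.gradLogp x z)).smulRight (Q.gradFt x z)‖
      ≤ GF * ‖Q.gradLogp x z‖ := by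
    rw [ContinuousLinearMap.norm_smulRight_apply, innerSL_apply_norm, mul_comm]
    gcongr
  have h2 : ‖(innerSL ℝ (Q.gradFt x z)).smulRight (Q.gradLogp x z)‖
      ≤ GF * ‖Q.gradLogp x z‖ := by
    rw [ContinuousLinearMap.norm_smulRight_apply, innerSL_apply_norm]
    gcongr
  have h3 : ‖Q.Ft x z • (Q.hessLogp x z +
      (innerSL ℝ (Q.gradLogp x z)).smulRight (Q.gradLogp x z))‖
      ≤ B * (‖Q.hessLogp x z‖ + ‖Q.gradLogp x z‖ ^ 2) := by
    rw [norm_smul]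
    refine mul_le_mul hB ((norm_add_le _ _).trans ?_) (norm_nonneg _) ((abs_nonneg _).trans hB)
    rw [ContinuousLinearMap.norm_smulRight_apply, innerSL_apply_norm, pow_two]
  have h4 := norm_add_le (Q.hessFt x z + (innerSL ℝ (Q.gradLogp x z)).smulRight (Q.gradFt x z)
    + (innerSL ℝ (Q.gradFt x z)).smulRight (Q.gradLogp x z)) (Q.Ft x z • (Q.hessLogp x z +
      (innerSL ℝ (Q.gradLogp x z)).smulRight (Q.gradLogp x z)))
  have h5 := norm_add_le (Q.hessFt x z + (innerSL ℝ (Q.gradLogp x z)).smulRight (Q.gradFt x z))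
    ((innerSL ℝ (Q.gradFt x z)).smulRight (Q.gradLogp x z))
  have h6 := norm_add_le (Q.hessFt x z) ((innerSL ℝ (Q.gradLogp x z)).smulRight (Q.gradFt x z))
  have h7 := hQ.hessFt_bound x hx z
  unfold hessEst
  linarith

theorem lintegral_gradEst_sq_le (hQ : Q.Assumptions D B GF LF Gp Lp L2F L2p)
    {x : EuclideanSpace ℝ (Fin n)} (hx : x ∈ Q.box) :
    ∫⁻ z, ENNReal.ofReal (‖Q.gradEst x z‖ ^ 2) ∂Q.sampleLaw x
      ≤ ENNReal.ofReal ((GF + B * Gp) ^ 2) := by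
  have := hQ.p_prob x hx
  obtain ⟨hB, hF, -⟩ := hQ.bounds_nonneg
  obtain ⟨-, h2, h1⟩ := hQ.gradLogp_moments hx
  have i1 : Integrable (fun z => GF ^ 2 + 2 * GF * B * ‖Q.gradLogp x z‖) (Q.sampleLaw x) :=
    (integrable_const _).add (h1.1.const_mul _)
  have hi : Integrable (fun z => GF ^ 2 + 2 * GF * B * ‖Q.gradLogp x z‖
      + B ^ 2 * ‖Q.gradLogp x z‖ ^ 2) (Q.sampleLaw x) :=
    i1.add (h2.1.const_mul _)
  calc _ ≤ ∫⁻ z, ENNReal.ofReal (GF ^ 2 + 2 * GF * B * ‖Q.gradLogp x z‖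
      + B ^ 2 * ‖Q.gradLogp x z‖ ^ 2) ∂Q.sampleLaw x := by
        refine lintegral_mono fun z => ENNReal.ofReal_le_ofReal ?_
        have := pow_le_pow_left₀ (norm_nonneg _) (hQ.norm_gradEst_le hx z) 2
        linarith
    _ = ENNReal.ofReal (∫ z, (GF ^ 2 + 2 * GF * B * ‖Q.gradLogp x z‖
      + B ^ 2 * ‖Q.gradLogp x z‖ ^ 2) ∂Q.sampleLaw x) :=
        (ofReal_integral_eq_lintegral_ofReal hi (ae_of_all _ fun z => by positivity)).symm
    _ ≤ _ := by
        refine ENNReal.ofReal_le_ofReal ?_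
        rw [integral_add i1 (h2.1.const_mul _),
          integral_add (integrable_const _) (h1.1.const_mul _), integral_const_mul,
          integral_const_mul]
        simp only [integral_const, probReal_univ, smul_eq_mul, one_mul]
        have e1 := mul_le_mul_of_nonneg_left h1.2 (by positivity : 0 ≤ 2 * GF * B)
        have e2 := mul_le_mul_of_nonneg_left h2.2 (by positivity : 0 ≤ B ^ 2)
        nlinarith

/-- The operator norm is bounded by four terms, one from each of ∇²F̃, the two mixed rank-one terms
together, ∇²log p, and the square of ∇log p. The inequality (a + b + c + d)² ≤ 4(a² + b² + c² + d²)
then produces the constants in L²; 16 is 4 times the square of the factor 2 in the mixed term. -/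
theorem lintegral_hessEst_sq_le (hQ : Q.Assumptions D B GF LF Gp Lp L2F L2p) {L : ℝ}
    (hL : 4 * B ^ 2 * Gp ^ 4 + 16 * GF ^ 2 * Gp ^ 2 + 4 * LF ^ 2 + 4 * B ^ 2 * Lp ^ 2 ≤ L ^ 2)
    {x : EuclideanSpace ℝ (Fin n)} (hx : x ∈ Q.box) :
    ∫⁻ z, ENNReal.ofReal (‖Q.hessEst x z‖ ^ 2) ∂Q.sampleLaw x ≤ ENNReal.ofReal (L ^ 2) := by
  have := hQ.p_prob x hx
  obtain ⟨hB, hF, hLF⟩ := hQ.bounds_nonneg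
  obtain ⟨h4, h2, -⟩ := hQ.gradLogp_moments hx
  have hh := hQ.hessLogp_moment hx
  have i1 : Integrable (fun z => 4 * LF ^ 2 + 16 * GF ^ 2 * ‖Q.gradLogp x z‖ ^ 2)
      (Q.sampleLaw x) := (integrable_const _).add (h2.1.const_mul _)
  have i2 : Integrable (fun z => 4 * LF ^ 2 + 16 * GF ^ 2 * ‖Q.gradLogp x z‖ ^ 2
      + 4 * B ^ 2 * ‖Q.hessLogp x z‖ ^ 2) (Q.sampleLaw x) := i1.add (hh.1.const_mul _)
  have hi : Integrable (fun z => 4 * LF ^ 2 + 16 * GF ^ 2 * ‖Q.gradLogp x z‖ ^ 2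
      + 4 * B ^ 2 * ‖Q.hessLogp x z‖ ^ 2 + 4 * B ^ 2 * ‖Q.gradLogp x z‖ ^ 4) (Q.sampleLaw x) :=
    i2.add (h4.1.const_mul _)
  calc _ ≤ ∫⁻ z, ENNReal.ofReal (4 * LF ^ 2 + 16 * GF ^ 2 * ‖Q.gradLogp x z‖ ^ 2
      + 4 * B ^ 2 * ‖Q.hessLogp x z‖ ^ 2 + 4 * B ^ 2 * ‖Q.gradLogp x z‖ ^ 4) ∂Q.sampleLaw x := by
        refine lintegral_mono fun z => ENNReal.ofReal_le_ofReal ?_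
        have h := pow_le_pow_left₀ (norm_nonneg _) (hQ.norm_hessEst_le hx z) 2
        have four : ∀ a b c d : ℝ, (a + b + c + d) ^ 2
            ≤ 4 * a ^ 2 + 4 * b ^ 2 + 4 * c ^ 2 + 4 * d ^ 2 := fun a b c d => by
          nlinarith [sq_nonneg (a - b), sq_nonneg (a - c), sq_nonneg (a - d), sq_nonneg (b - c),
            sq_nonneg (b - d), sq_nonneg (c - d)]
        refine h.trans ((four _ _ _ _).trans (le_of_eq ?_))
        ring
    _ = ENNReal.ofReal (∫ z, (4 * LF ^ 2 + 16 * GF ^ 2 * ‖Q.gradLogp x z‖ ^ 2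
      + 4 * B ^ 2 * ‖Q.hessLogp x z‖ ^ 2 + 4 * B ^ 2 * ‖Q.gradLogp x z‖ ^ 4) ∂Q.sampleLaw x) :=
        (ofReal_integral_eq_lintegral_ofReal hi (ae_of_all _ fun z => by positivity)).symm
    _ ≤ _ := by
        refine ENNReal.ofReal_le_ofReal ?_
        rw [integral_add i2 (h4.1.const_mul _), integral_add i1 (hh.1.const_mul _),
          integral_add (integrable_const _) (h2.1.const_mul _), integral_const_mul,
          integral_const_mul, integral_const_mul]
        simp only [integral_const_mul, integral_const, probReal_univ, smul_eq_mul, one_mul]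
        have e1 := mul_le_mul_of_nonneg_left h2.2 (by positivity : 0 ≤ 16 * GF ^ 2)
        have e2 := mul_le_mul_of_nonneg_left h4.2 (by positivity : 0 ≤ 4 * B ^ 2)
        have e3 := mul_le_mul_of_nonneg_left hh.2 (by positivity : 0 ≤ 4 * B ^ 2)
        linarith

theorem integral_sampleLaw (hQ : Q.Assumptions D B GF LF Gp Lp L2F L2p)
    {E : Type*} [NormedAddCommGroup E] [NormedSpace ℝ E]
    {x : EuclideanSpace ℝ (Fin n)} (hx : x ∈ Q.box) (f : Z → E) :
    ∫ z, f z ∂Q.sampleLaw x = ∫ z, Q.p x z • f z ∂Q.ν := by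
  unfold sampleLaw
  rw [integral_withDensity_eq_integral_toReal_smul (hQ.p_measurable x hx).ennreal_ofReal
    (ae_of_all _ fun z => ENNReal.ofReal_lt_top)]
  exact integral_congr_ae (ae_of_all _ fun z => by
    simp only [ENNReal.toReal_ofReal (hQ.p_pos x hx z).le])

theorem integrable_sampleLaw_iff (hQ : Q.Assumptions D B GF LF Gp Lp L2F L2p)
    {E : Type*} [NormedAddCommGroup E] [NormedSpace ℝ E]
    {x : EuclideanSpace ℝ (Fin n)} (hx : x ∈ Q.box) {f : Z → E} :
    Integrable f (Q.sampleLaw x) ↔ Integrable (fun z => Q.p x z • f z) Q.ν := by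
  unfold sampleLaw
  rw [integrable_withDensity_iff_integrable_smul' (hQ.p_measurable x hx).ennreal_ofReal
    (ae_of_all _ fun z => ENNReal.ofReal_lt_top)]
  exact integrable_congr (ae_of_all _ fun z => by
    simp only [ENNReal.toReal_ofReal (hQ.p_pos x hx z).le])

theorem integrable_Ft (hQ : Q.Assumptions D B GF LF Gp Lp L2F L2p)
    {x : EuclideanSpace ℝ (Fin n)} (hx : x ∈ Q.box) : Integrable (Q.Ft x) (Q.sampleLaw x) := by
  have := hQ.p_prob x hx
  exact Integrable.of_bound (hQ.Ft_measurable x hx).aestronglyMeasurable B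
    (ae_of_all _ fun z => hQ.Ft_bound x hx z)

theorem _root_.memLp_two_of_lintegral_norm_sq_le {Ω : Type*} {mΩ : MeasurableSpace Ω}
    {μ : Measure Ω} {E : Type*} [NormedAddCommGroup E] {f : Ω → E}
    (hf : AEStronglyMeasurable f μ) {c : ℝ} (hc : 0 ≤ c)
    (h : ∫⁻ ω, ENNReal.ofReal (‖f ω‖ ^ 2) ∂μ ≤ ENNReal.ofReal c) :
    MemLp f 2 μ ∧ ∫ ω, ‖f ω‖ ^ 2 ∂μ ≤ c := by
  have := integrable_and_integral_le_of_lintegral_ofReal_le (f := fun ω => ‖f ω‖ ^ 2)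
    (hf.norm.pow 2)
    (fun ω => by positivity) hc h
  exact ⟨(memLp_two_iff_integrable_sq_norm hf).2 this.1, this.2⟩

theorem memLp_gradEst (hQ : Q.Assumptions D B GF LF Gp Lp L2F L2p)
    {x : EuclideanSpace ℝ (Fin n)} (hx : x ∈ Q.box) :
    MemLp (Q.gradEst x) 2 (Q.sampleLaw x) ∧
      ∫ z, ‖Q.gradEst x z‖ ^ 2 ∂Q.sampleLaw x ≤ (GF + B * Gp) ^ 2 :=
  memLp_two_of_lintegral_norm_sq_le (hQ.measurable_gradEst hx).aestronglyMeasurable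
    (sq_nonneg _) (hQ.lintegral_gradEst_sq_le hx)

end SampleLaw

/-! ### The law of a uniform point on a segment together with its sample. -/

section PairLaw

theorem _root_.ae_fst_mem_Icc (ν : Measure Z) :
    ∀ᵐ az ∂((volume.restrict (Icc (0 : ℝ) 1)).prod ν), az.1 ∈ Icc (0 : ℝ) 1 :=
  Measure.quasiMeasurePreserving_fst.ae (ae_restrict_mem measurableSet_Icc)

variable {x y : EuclideanSpace ℝ (Fin n)}

theorem ae_pairLaw_mem_Icc : ∀ᵐ az ∂(Q.pairLaw x y), az.1 ∈ Icc (0 : ℝ) 1 :=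
  (withDensity_absolutelyContinuous _ _).ae_le (ae_fst_mem_Icc Q.ν)

theorem measurable_p_clamp (hQ : Q.Assumptions D B GF LF Gp Lp L2F L2p) :
    Measurable fun q : EuclideanSpace ℝ (Fin n) × Z => Q.p (Q.clamp q.1) q.2 :=
  (stronglyMeasurable_uncurry_clamp hQ.u_pos hQ.continuousOn_p
    fun x hx => (hQ.p_measurable x hx).stronglyMeasurable).measurable

/-- The density of `pairLaw`, modified outside of `[0, 1]`, is measurable. -/
theorem measurable_p_clamp_segPoint (hQ : Q.Assumptions D B GF LF Gp Lp L2F L2p)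
    (x y : EuclideanSpace ℝ (Fin n)) :
    Measurable fun az : ℝ × Z => Q.p (Q.clamp (segPoint x y az.1)) az.2 :=
  hQ.measurable_p_clamp.comp
    (((continuous_segPoint x y).measurable.comp measurable_fst).prodMk measurable_snd)

/-- Outside [0, 1] the original density may be evaluated off the box, where it need not be
measurable; the retracted density agrees with it almost everywhere. -/
theorem pairLaw_eq (hx : x ∈ Q.box) (hy : y ∈ Q.box) :
    Q.pairLaw x y = ((volume.restrict (Icc (0 : ℝ) 1)).prod Q.ν).withDensity
      fun az => ENNReal.ofReal (Q.p (Q.clamp (segPoint x y az.1)) az.2) := by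
  refine withDensity_congr_ae ?_
  filter_upwards [ae_fst_mem_Icc Q.ν] with az haz
  rw [clamp_eq_self (segPoint_mem hx hy haz)]
  rfl

theorem lintegral_pairLaw (hQ : Q.Assumptions D B GF LF Gp Lp L2F L2p) (hx : x ∈ Q.box)
    (hy : y ∈ Q.box) {f : ℝ × Z → ENNReal} (hf : Measurable f) :
    ∫⁻ az, f az ∂Q.pairLaw x y
      = ∫⁻ a in Icc (0 : ℝ) 1, ∫⁻ z, f (a, z) ∂Q.sampleLaw (segPoint x y a) := by
  have := hQ.sigmaFinite
  have hm := (hQ.measurable_p_clamp_segPoint x y).ennreal_ofReal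
  rw [pairLaw_eq hx hy, lintegral_withDensity_eq_lintegral_mul _ hm hf, lintegral_prod _
    (hm.mul hf).aemeasurable]
  refine setLIntegral_congr_fun measurableSet_Icc fun a ha => ?_
  have hs := segPoint_mem hx hy ha
  simp only [Pi.mul_apply, clamp_eq_self hs]
  unfold sampleLaw
  rw [lintegral_withDensity_eq_lintegral_mul _ (hQ.p_measurable _ hs).ennreal_ofReal
    (g := fun z => f (a, z)) (hf.comp measurable_prodMk_left)]
  rfl

theorem isProbabilityMeasure_pairLaw (hQ : Q.Assumptions D B GF LF Gp Lp L2F L2p) (hx : x ∈ Q.box)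
    (hy : y ∈ Q.box) : IsProbabilityMeasure (Q.pairLaw x y) := by
  constructor
  rw [← lintegral_one, hQ.lintegral_pairLaw hx hy measurable_const]
  have : ∀ a ∈ Icc (0 : ℝ) 1, ∫⁻ _, 1 ∂Q.sampleLaw (segPoint x y a) = 1 := fun a ha => by
    have := hQ.p_prob _ (segPoint_mem hx hy ha)
    simp
  rw [setLIntegral_congr_fun measurableSet_Icc this]
  simp

theorem aestronglyMeasurable_comp_segPoint (hQ : Q.Assumptions D B GF LF Gp Lp L2F L2p)
    (hx : x ∈ Q.box) (hy : y ∈ Q.box) {E : Type*} [TopologicalSpace E]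
    [TopologicalSpace.PseudoMetrizableSpace E] {f : EuclideanSpace ℝ (Fin n) → Z → E}
    (hc : ∀ z, ContinuousOn (fun x => f x z) Q.box)
    (hm : ∀ x ∈ Q.box, StronglyMeasurable (f x)) :
    AEStronglyMeasurable (fun az : ℝ × Z => f (segPoint x y az.1) az.2) (Q.pairLaw x y) := by
  have h := (stronglyMeasurable_uncurry_clamp hQ.u_pos hc hm).comp_measurable
    (((continuous_segPoint x y).measurable.comp measurable_fst).prodMk
      (measurable_snd : Measurable (Prod.snd : ℝ × Z → Z)))
  refine ⟨_, h, ?_⟩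
  filter_upwards [ae_pairLaw_mem_Icc (Q := Q) (x := x) (y := y)] with az haz
  simp [Function.comp, clamp_eq_self (segPoint_mem hx hy haz)]

/-- Under `pairLaw` a second moment is an average over `a` of second moments at points of the box,
so a uniform bound is preserved. -/
theorem lintegral_norm_sq_pairLaw_le (hQ : Q.Assumptions D B GF LF Gp Lp L2F L2p)
    (hx : x ∈ Q.box) (hy : y ∈ Q.box) {E : Type*} [NormedAddCommGroup E]
    {f : EuclideanSpace ℝ (Fin n) → Z → E}
    (hc : ∀ z, ContinuousOn (fun x => f x z) Q.box)
    (hm : ∀ x ∈ Q.box, StronglyMeasurable (f x)) {c : ENNReal}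
    (h : ∀ x ∈ Q.box, ∫⁻ z, ENNReal.ofReal (‖f x z‖ ^ 2) ∂Q.sampleLaw x ≤ c) :
    ∫⁻ az, ENNReal.ofReal (‖f (segPoint x y az.1) az.2‖ ^ 2) ∂Q.pairLaw x y ≤ c := by
  have h' := (stronglyMeasurable_uncurry_clamp hQ.u_pos hc hm).comp_measurable
    (((continuous_segPoint x y).measurable.comp measurable_fst).prodMk
      (measurable_snd : Measurable (Prod.snd : ℝ × Z → Z)))
  calc _ = ∫⁻ az, ENNReal.ofReal (‖f (Q.clamp (segPoint x y az.1)) az.2‖ ^ 2)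
        ∂Q.pairLaw x y := by
        refine lintegral_congr_ae ?_
        filter_upwards [ae_pairLaw_mem_Icc (Q := Q) (x := x) (y := y)] with az haz
        simp [clamp_eq_self (segPoint_mem hx hy haz)]
    _ = ∫⁻ a in Icc (0 : ℝ) 1, ∫⁻ z,
        ENNReal.ofReal (‖f (Q.clamp (segPoint x y a)) z‖ ^ 2) ∂Q.sampleLaw (segPoint x y a) :=
        hQ.lintegral_pairLaw hx hy (f := fun az =>
          ENNReal.ofReal (‖f (Q.clamp (segPoint x y az.1)) az.2‖ ^ 2))
          (h'.norm.measurable.pow_const 2).ennreal_ofReal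
    _ ≤ ∫⁻ _ in Icc (0 : ℝ) 1, c := by
        refine setLIntegral_mono measurable_const fun a ha => ?_
        rw [clamp_eq_self (segPoint_mem hx hy ha)]
        exact h _ (segPoint_mem hx hy ha)
    _ = c := by simp

theorem integral_pairLaw (hQ : Q.Assumptions D B GF LF Gp Lp L2F L2p) (hx : x ∈ Q.box)
    (hy : y ∈ Q.box) {E : Type*} [NormedAddCommGroup E] [NormedSpace ℝ E] (f : ℝ × Z → E) :
    ∫ az, f az ∂Q.pairLaw x y = ∫ az, Q.p (segPoint x y az.1) az.2 • f az
      ∂((volume.restrict (Icc (0 : ℝ) 1)).prod Q.ν) := by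
  rw [pairLaw_eq hx hy, integral_withDensity_eq_integral_toReal_smul
    (hQ.measurable_p_clamp_segPoint x y).ennreal_ofReal
    (ae_of_all _ fun z => ENNReal.ofReal_lt_top)]
  refine integral_congr_ae ?_
  filter_upwards [ae_fst_mem_Icc Q.ν] with az haz
  have hs := segPoint_mem hx hy haz
  rw [clamp_eq_self hs, ENNReal.toReal_ofReal (hQ.p_pos _ hs _).le]

theorem integrable_pairLaw_iff (hQ : Q.Assumptions D B GF LF Gp Lp L2F L2p) (hx : x ∈ Q.box)
    (hy : y ∈ Q.box) {E : Type*} [NormedAddCommGroup E] [NormedSpace ℝ E] {f : ℝ × Z → E} :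
    Integrable f (Q.pairLaw x y) ↔ Integrable (fun az => Q.p (segPoint x y az.1) az.2 • f az)
      ((volume.restrict (Icc (0 : ℝ) 1)).prod Q.ν) := by
  rw [pairLaw_eq hx hy, integrable_withDensity_iff_integrable_smul'
    (hQ.measurable_p_clamp_segPoint x y).ennreal_ofReal
    (ae_of_all _ fun z => ENNReal.ofReal_lt_top)]
  refine integrable_congr ?_
  filter_upwards [ae_fst_mem_Icc Q.ν] with az haz
  have hs := segPoint_mem hx hy haz
  rw [clamp_eq_self hs, ENNReal.toReal_ofReal (hQ.p_pos _ hs _).le]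

theorem integral_pairLaw_eq_integral_integral (hQ : Q.Assumptions D B GF LF Gp Lp L2F L2p)
    (hx : x ∈ Q.box) (hy : y ∈ Q.box) {E : Type*} [NormedAddCommGroup E] [NormedSpace ℝ E]
    {f : ℝ × Z → E} (hf : Integrable f (Q.pairLaw x y)) :
    ∫ az, f az ∂Q.pairLaw x y
      = ∫ a in Icc (0 : ℝ) 1, ∫ z, f (a, z) ∂Q.sampleLaw (segPoint x y a) := by
  have := hQ.sigmaFinite
  rw [hQ.integral_pairLaw hx hy, integral_prod _ ((hQ.integrable_pairLaw_iff hx hy).1 hf)]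
  refine setIntegral_congr_fun measurableSet_Icc fun a ha => ?_
  exact (hQ.integral_sampleLaw (segPoint_mem hx hy ha) _).symm

theorem memLp_gradEst_pairLaw (hQ : Q.Assumptions D B GF LF Gp Lp L2F L2p) (hx : x ∈ Q.box)
    (hy : y ∈ Q.box) :
    MemLp (fun az : ℝ × Z => Q.gradEst (segPoint x y az.1) az.2) 2 (Q.pairLaw x y) :=
  (memLp_two_of_lintegral_norm_sq_le
    (hQ.aestronglyMeasurable_comp_segPoint hx hy hQ.continuousOn_gradEst
      fun _ hx => hQ.measurable_gradEst hx) (sq_nonneg _)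
    (hQ.lintegral_norm_sq_pairLaw_le hx hy hQ.continuousOn_gradEst
      (fun _ hx => hQ.measurable_gradEst hx) fun _ hx => hQ.lintegral_gradEst_sq_le hx)).1

theorem memLp_hessEst_pairLaw (hQ : Q.Assumptions D B GF LF Gp Lp L2F L2p) {L : ℝ}
    (hL : 4 * B ^ 2 * Gp ^ 4 + 16 * GF ^ 2 * Gp ^ 2 + 4 * LF ^ 2 + 4 * B ^ 2 * Lp ^ 2 ≤ L ^ 2)
    (hx : x ∈ Q.box) (hy : y ∈ Q.box) :
    MemLp (fun az : ℝ × Z => Q.hessEst (segPoint x y az.1) az.2) 2 (Q.pairLaw x y) ∧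
      ∫ az, ‖Q.hessEst (segPoint x y az.1) az.2‖ ^ 2 ∂Q.pairLaw x y ≤ L ^ 2 :=
  memLp_two_of_lintegral_norm_sq_le
    (hQ.aestronglyMeasurable_comp_segPoint hx hy hQ.continuousOn_hessEst
      fun _ hx => hQ.measurable_hessEst hx) (sq_nonneg _)
    (hQ.lintegral_norm_sq_pairLaw_le hx hy hQ.continuousOn_hessEst
      (fun _ hx => hQ.measurable_hessEst hx) fun _ hx => hQ.lintegral_hessEst_sq_le hL hx)

end PairLaw

end Assumptions

end StochProblem

/-! ### The objective: integral formulas, smoothness, and the DR-submodular inequality. -/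

theorem nonpos_of_forall_le_div_succ {a b : ℝ} (h : ∀ N : ℕ, a ≤ b / ((N : ℝ) + 1)) : a ≤ 0 :=
  ge_of_tendsto' (tendsto_const_nhds.div_atTop
    (tendsto_atTop_add_const_right _ _ tendsto_natCast_atTop_atTop)) h

namespace StochProblem

/-- The expectation of the gradient estimate. -/
noncomputable def gradF {n : ℕ} {Z : Type*} [MeasurableSpace Z] (Q : StochProblem n Z)
    (x : EuclideanSpace ℝ (Fin n)) : EuclideanSpace ℝ (Fin n) :=
  ∫ z, Q.gradEst x z ∂Q.sampleLaw x

namespace Assumptions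

variable {n : ℕ} {Z : Type*} [MeasurableSpace Z] {Q : StochProblem n Z}
  {D B GF LF Gp Lp L2F L2p L : ℝ} {x y : EuclideanSpace ℝ (Fin n)}

/-- The fundamental theorem of calculus is applied to p·F̃ on the segment for each `z`, then
integrated over `z`; the moment bounds supply the joint integrability that Fubini needs. -/
theorem F_sub_eq_integral_pairLaw (hQ : Q.Assumptions D B GF LF Gp Lp L2F L2p) (hx : x ∈ Q.box)
    (hy : y ∈ Q.box) : Q.F x - Q.F y
      = ∫ az, ⟪Q.gradEst (segPoint x y az.1) az.2, x - y⟫_ℝ ∂Q.pairLaw x y := by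
  have := hQ.sigmaFinite
  have := hQ.isProbabilityMeasure_pairLaw hx hy
  have hint : Integrable (fun az : ℝ × Z => ⟪Q.gradEst (segPoint x y az.1) az.2, x - y⟫_ℝ)
      (Q.pairLaw x y) :=
    ((hQ.memLp_gradEst_pairLaw hx hy).integrable one_le_two).inner_const _
  rw [hQ.integral_pairLaw hx hy]
  have h := integral_sub_integral_eq_of_hasDerivAt Q.ν
    (φ := fun a z => Q.p (segPoint x y a) z • Q.Ft (segPoint x y a) z)
    (φ' := fun a z => Q.p (segPoint x y a) z • ⟪Q.gradEst (segPoint x y a) z, x - y⟫_ℝ)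
    (fun z => continuousOn_comp_segPoint (f := fun w => Q.p w z • Q.Ft w z) hx hy
      ((hQ.continuousOn_p z).smul (hQ.Ft_smooth z).continuousOn))
    (fun z a ha => hasDerivAt_comp_segPoint hx hy ha
      (hQ.hasFDerivWithinAt_p_smul_Ft (segPoint_mem hx hy (Ioo_subset_Icc_self ha)) z))
    (fun z => continuousOn_comp_segPoint (f := fun w => Q.p w z • ⟪Q.gradEst w z, x - y⟫_ℝ) hx hy
      ((hQ.continuousOn_p z).smul ((hQ.continuousOn_gradEst z).inner continuousOn_const)))
    ((hQ.integrable_pairLaw_iff hx hy).1 hint)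
    (by simpa only [segPoint_zero] using (hQ.integrable_sampleLaw_iff hy).1 (hQ.integrable_Ft hy))
    (by simpa only [segPoint_one] using (hQ.integrable_sampleLaw_iff hx).1 (hQ.integrable_Ft hx))
  simp only [segPoint_zero, segPoint_one] at h
  rw [← h, F, F, hQ.integral_sampleLaw hx, hQ.integral_sampleLaw hy]

/-- The same argument one order higher. It states that a sampled Hessian applied to the step is an
unbiased estimate of the change of `gradF`. -/
theorem gradF_sub_eq_integral_pairLaw (hQ : Q.Assumptions D B GF LF Gp Lp L2F L2p)
    (hL : 4 * B ^ 2 * Gp ^ 4 + 16 * GF ^ 2 * Gp ^ 2 + 4 * LF ^ 2 + 4 * B ^ 2 * Lp ^ 2 ≤ L ^ 2)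
    (hx : x ∈ Q.box) (hy : y ∈ Q.box) : Q.gradF x - Q.gradF y
      = ∫ az, Q.hessEst (segPoint x y az.1) az.2 (x - y) ∂Q.pairLaw x y := by
  have := hQ.sigmaFinite
  have := hQ.isProbabilityMeasure_pairLaw hx hy
  have := hQ.p_prob x hx
  have := hQ.p_prob y hy
  have hint : Integrable (fun az : ℝ × Z => Q.hessEst (segPoint x y az.1) az.2 (x - y))
      (Q.pairLaw x y) :=
    ((hQ.memLp_hessEst_pairLaw hL hx hy).1.integrable one_le_two).apply_continuousLinearMap _
  have hix := (hQ.integrable_sampleLaw_iff hx).1 ((hQ.memLp_gradEst hx).1.integrable one_le_two)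
  have hiy := (hQ.integrable_sampleLaw_iff hy).1 ((hQ.memLp_gradEst hy).1.integrable one_le_two)
  rw [hQ.integral_pairLaw hx hy]
  have h := integral_sub_integral_eq_of_hasDerivAt Q.ν
    (φ := fun a z => Q.p (segPoint x y a) z • Q.gradEst (segPoint x y a) z)
    (φ' := fun a z => Q.p (segPoint x y a) z • Q.hessEst (segPoint x y a) z (x - y))
    (fun z => continuousOn_comp_segPoint (f := fun w => Q.p w z • Q.gradEst w z) hx hy
      ((hQ.continuousOn_p z).smul (hQ.continuousOn_gradEst z)))
    (fun z a ha => hasDerivAt_comp_segPoint hx hy ha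
      (hQ.hasFDerivWithinAt_p_smul_gradEst (segPoint_mem hx hy (Ioo_subset_Icc_self ha)) z))
    (fun z => continuousOn_comp_segPoint (f := fun w => Q.p w z • Q.hessEst w z (x - y)) hx hy
      ((hQ.continuousOn_p z).smul ((hQ.continuousOn_hessEst z).clm_apply continuousOn_const)))
    ((hQ.integrable_pairLaw_iff hx hy).1 hint)
    (by simpa only [segPoint_zero] using hiy) (by simpa only [segPoint_one] using hix)
  simp only [segPoint_zero, segPoint_one] at h
  rw [← h, gradF, gradF, hQ.integral_sampleLaw hx, hQ.integral_sampleLaw hy]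

theorem norm_gradF_sub_le (hQ : Q.Assumptions D B GF LF Gp Lp L2F L2p) (hL0 : 0 ≤ L)
    (hL : 4 * B ^ 2 * Gp ^ 4 + 16 * GF ^ 2 * Gp ^ 2 + 4 * LF ^ 2 + 4 * B ^ 2 * Lp ^ 2 ≤ L ^ 2)
    (hx : x ∈ Q.box) (hy : y ∈ Q.box) : ‖Q.gradF x - Q.gradF y‖ ≤ L * ‖x - y‖ := by
  have := hQ.isProbabilityMeasure_pairLaw hx hy
  obtain ⟨hm, hle⟩ := hQ.memLp_hessEst_pairLaw hL hx hy
  obtain ⟨hi, hI⟩ := integrable_and_integral_le_of_integral_sq_le hm.aestronglyMeasurable.norm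
    (fun _ => norm_nonneg _) hL0 ((memLp_two_iff_integrable_sq_norm hm.1).1 hm) hle
  rw [hQ.gradF_sub_eq_integral_pairLaw hL hx hy]
  refine (norm_integral_le_integral_norm _).trans ?_
  calc _ ≤ ∫ az, ‖Q.hessEst (segPoint x y az.1) az.2‖ * ‖x - y‖ ∂Q.pairLaw x y :=
        integral_mono_of_nonneg (ae_of_all _ fun _ => norm_nonneg _) (hi.mul_const _)
          (ae_of_all _ fun az => ContinuousLinearMap.le_opNorm _ _)
    _ ≤ _ := by
        rw [integral_mul_const]
        gcongr

theorem continuousOn_gradF (hQ : Q.Assumptions D B GF LF Gp Lp L2F L2p) (hL0 : 0 ≤ L)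
    (hL : 4 * B ^ 2 * Gp ^ 4 + 16 * GF ^ 2 * Gp ^ 2 + 4 * LF ^ 2 + 4 * B ^ 2 * Lp ^ 2 ≤ L ^ 2) :
    ContinuousOn Q.gradF Q.box :=
  (LipschitzOnWith.of_dist_le_mul (K := ⟨L, hL0⟩) fun x hx y hy => by
    rw [dist_eq_norm, dist_eq_norm]
    exact hQ.norm_gradF_sub_le hL0 hL hx hy).continuousOn

theorem abs_F_sub_sub_inner_le (hQ : Q.Assumptions D B GF LF Gp Lp L2F L2p) (hL0 : 0 ≤ L)
    (hL : 4 * B ^ 2 * Gp ^ 4 + 16 * GF ^ 2 * Gp ^ 2 + 4 * LF ^ 2 + 4 * B ^ 2 * Lp ^ 2 ≤ L ^ 2)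
    (hx : x ∈ Q.box) (hy : y ∈ Q.box) :
    |Q.F x - Q.F y - ⟪Q.gradF y, x - y⟫_ℝ| ≤ L / 2 * ‖x - y‖ ^ 2 := by
  have := hQ.isProbabilityMeasure_pairLaw hx hy
  have hint : Integrable (fun az : ℝ × Z => ⟪Q.gradEst (segPoint x y az.1) az.2, x - y⟫_ℝ)
      (Q.pairLaw x y) :=
    ((hQ.memLp_gradEst_pairLaw hx hy).integrable one_le_two).inner_const _
  have h1 : Q.F x - Q.F y = ∫ a in (0 : ℝ)..1, ⟪Q.gradF (segPoint x y a), x - y⟫_ℝ := by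
    rw [hQ.F_sub_eq_integral_pairLaw hx hy,
      hQ.integral_pairLaw_eq_integral_integral hx hy hint,
      intervalIntegral.integral_of_le zero_le_one, ← integral_Icc_eq_integral_Ioc]
    refine setIntegral_congr_fun measurableSet_Icc fun a ha => ?_
    have hs := segPoint_mem hx hy ha
    have := hQ.p_prob _ hs
    have hi := (hQ.memLp_gradEst hs).1.integrable one_le_two
    simp only [gradF, real_inner_comm (x - y)]
    exact integral_inner hi _
  have hcont : ContinuousOn (fun a => ⟪Q.gradF (segPoint x y a), x - y⟫_ℝ) (Icc 0 1) :=
    (continuousOn_comp_segPoint hx hy (hQ.continuousOn_gradF hL0 hL)).inner continuousOn_const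
  have h2 : Q.F x - Q.F y - ⟪Q.gradF y, x - y⟫_ℝ
      = ∫ a in (0 : ℝ)..1, ⟪Q.gradF (segPoint x y a) - Q.gradF y, x - y⟫_ℝ := by
    simp only [inner_sub_left]
    rw [intervalIntegral.integral_sub (ContinuousOn.intervalIntegrable (by simpa using hcont))
      intervalIntegrable_const, h1]
    simp
  have hsq : ∫ a in (0 : ℝ)..1, L * a * ‖x - y‖ ^ 2 = L / 2 * ‖x - y‖ ^ 2 := by
    rw [intervalIntegral.integral_mul_const, intervalIntegral.integral_const_mul, integral_id]
    ring
  rw [h2, ← hsq, ← Real.norm_eq_abs]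
  refine intervalIntegral.norm_integral_le_of_norm_le zero_le_one (ae_of_all _ fun a ha => ?_)
    (Continuous.intervalIntegrable (by fun_prop) _ _)
  have hb := hQ.norm_gradF_sub_le hL0 hL (segPoint_mem hx hy (Ioc_subset_Icc_self ha)) hy
  rw [segPoint_sub, norm_smul, Real.norm_of_nonneg ha.1.le] at hb
  calc _ ≤ ‖Q.gradF (segPoint x y a) - Q.gradF y‖ * ‖x - y‖ := norm_inner_le_norm _ _
    _ ≤ L * (a * ‖x - y‖) * ‖x - y‖ := by gcongr
    _ = _ := by ring

/-- Monotonicity compared with the first-order expansion along ±e_i: after division by the step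
length the quadratic error vanishes in the limit. -/
theorem gradF_nonneg (hQ : Q.Assumptions D B GF LF Gp Lp L2F L2p) (hL0 : 0 ≤ L)
    (hL : 4 * B ^ 2 * Gp ^ 4 + 16 * GF ^ 2 * Gp ^ 2 + 4 * LF ^ 2 + 4 * B ^ 2 * Lp ^ 2 ≤ L ^ 2)
    (hx : x ∈ Q.box) (i : Fin n) : 0 ≤ Q.gradF x i := by
  obtain ⟨c, hc, hseg⟩ := exists_segment_mem_box hQ.u_pos hx i
  have key : ∀ N : ℕ, -(|c| * Q.gradF x i) ≤ (L / 2 * c ^ 2) / ((N : ℝ) + 1) := by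
    intro N
    set k : ℝ := ((N : ℝ) + 1)⁻¹ with hk
    have hk0 : 0 < k := by positivity
    have hk1 : k ≤ 1 := inv_le_one_of_one_le₀ (by linarith [(Nat.cast_nonneg N : (0:ℝ) ≤ N)])
    have hm := hseg k ⟨hk0.le, hk1⟩
    have hb := hQ.abs_F_sub_sub_inner_le hL0 hL hm hx
    rw [add_sub_cancel_left, smul_smul, inner_smul_right, norm_smul,
      EuclideanSpace.inner_single_right, PiLp.norm_single] at hb
    simp only [one_mul, norm_one, mul_one, Real.norm_eq_abs, sq_abs, conj_trivial] at hb
    rw [abs_le] at hb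
    rw [smul_smul] at hm
    rw [div_eq_mul_inv, ← hk]
    refine le_of_mul_le_mul_left ?_ hk0
    -- If the available direction is downwards, moving decreases F, and both signs flip.
    rcases lt_or_gt_of_ne hc with h | h
    · have hmono := hQ.monotone _ hm x hx fun j => by
        rcases eq_or_ne j i with rfl | hj
        · simp; nlinarith
        · simp [hj]
      rw [abs_of_neg h]
      nlinarith [hb.1]
    · have hmono := hQ.monotone x hx _ hm fun j => by
        rcases eq_or_ne j i with rfl | hj
        · simp; positivity
        · simp [hj]
      rw [abs_of_pos h]
      nlinarith [hb.2]
  have h0 := nonpos_of_forall_le_div_succ key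
  have : 0 < |c| := abs_pos.2 hc
  nlinarith

/-- Concavity along a coordinate direction, from diminishing returns. -/
theorem F_add_single_sub_le (hQ : Q.Assumptions D B GF LF Gp Lp L2F L2p) (hL0 : 0 ≤ L)
    (hL : 4 * B ^ 2 * Gp ^ 4 + 16 * GF ^ 2 * Gp ^ 2 + 4 * LF ^ 2 + 4 * B ^ 2 * Lp ^ 2 ≤ L ^ 2)
    (hx : x ∈ Q.box) (i : Fin n) {k : ℝ} (hk : 0 ≤ k)
    (hxk : x + EuclideanSpace.single i k ∈ Q.box) :
    Q.F (x + EuclideanSpace.single i k) - Q.F x ≤ k * Q.gradF x i := by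
  have hmem : ∀ s : ℝ, 0 ≤ s → s ≤ k → x + EuclideanSpace.single i s ∈ Q.box := by
    intro s hs0 hsk j
    rcases eq_or_ne j i with rfl | hj
    · have h1 := hx j
      have h2 := hxk j
      simp only [PiLp.add_apply, PiLp.single_apply, if_true] at h2 ⊢
      constructor <;> linarith
    · simpa [hj] using hx j
  have key : ∀ N : ℕ, Q.F (x + EuclideanSpace.single i k) - Q.F x - k * Q.gradF x i
      ≤ (L / 2 * k ^ 2) / ((N : ℝ) + 1) := by
    intro N
    have hN : (0 : ℝ) < (N : ℝ) + 1 := by positivity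
    set s : ℝ := k / ((N : ℝ) + 1) with hs
    have hsN : ((N : ℝ) + 1) * s = k := by rw [hs]; field_simp
    have hs0 : 0 ≤ s := by positivity
    -- The segment is cut into N + 1 equal pieces of length `s`; by diminishing returns no piece
    -- gains more than the first.
    have chain : ∀ m : ℕ, m ≤ N + 1 → Q.F (x + EuclideanSpace.single i (m * s)) - Q.F x
        ≤ m * (Q.F (x + EuclideanSpace.single i s) - Q.F x) := by
      intro m
      induction m with
      | zero =>
        have h0 : EuclideanSpace.single i (0 : ℝ) = 0 := by ext j; simp
        simp [h0]
      | succ m ih =>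
        intro hm
        have hm' : ((m : ℝ) + 1) ≤ N + 1 := by exact_mod_cast hm
        have h1 : ((m : ℝ) + 1) * s ≤ k := by rw [← hsN]; gcongr
        have hms : 0 ≤ (m : ℝ) * s := by positivity
        have h2 : x + EuclideanSpace.single i ((m : ℝ) * s) + EuclideanSpace.single i s
            = x + EuclideanSpace.single i (((m : ℝ) + 1) * s) := by
          rw [add_assoc, ← PiLp.single_add]
          ring_nf
        have h3 := hQ.dr x hx (x + EuclideanSpace.single i ((m : ℝ) * s))
          (hmem _ hms (by nlinarith)) (fun j => by
            rcases eq_or_ne j i with rfl | hj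
            · simpa using hms
            · simp [hj]) i s hs0
          (hmem s hs0 (by nlinarith [(Nat.cast_nonneg m : (0:ℝ) ≤ m)]))
          (by rw [h2]; exact hmem _ (by positivity) h1)
        rw [h2] at h3
        have := ih (by omega)
        push_cast
        linarith
    have h1 := chain (N + 1) le_rfl
    push_cast at h1
    rw [hsN] at h1
    have hb := (abs_le.1 (hQ.abs_F_sub_sub_inner_le hL0 hL (hmem s hs0
      (by nlinarith [(Nat.cast_nonneg N : (0:ℝ) ≤ N)])) hx)).2
    rw [add_sub_cancel_left, EuclideanSpace.inner_single_right, PiLp.norm_single] at hb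
    simp only [Real.norm_eq_abs, sq_abs, conj_trivial] at hb
    -- N + 1 copies of the first-order error L/2 s² add up to L/2 k²/(N + 1), which tends to 0.
    have h2 := mul_le_mul_of_nonneg_left hb hN.le
    have h3 : (L / 2 * k ^ 2) / ((N : ℝ) + 1) = ((N : ℝ) + 1) * (L / 2 * s ^ 2) := by
      rw [hs]; field_simp
    rw [h3]
    have h4 : ((N : ℝ) + 1) * (s * Q.gradF x i) = k * Q.gradF x i := by rw [← hsN]; ring
    linarith
  linarith [nonpos_of_forall_le_div_succ key]

/-- Compare y with the join x ∨ y = x + h, where h = (y − x)⁺. Monotonicity gives F y ≤ F(x + h).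
Diminishing returns and concavity along axes give F(x + h) − F x ≤ ⟨gradF x, h⟩. Finally h ≤ y
because x ≥ 0, and `gradF` is nonnegative. -/
theorem F_sub_le_inner_gradF (hQ : Q.Assumptions D B GF LF Gp Lp L2F L2p) (hL0 : 0 ≤ L)
    (hL : 4 * B ^ 2 * Gp ^ 4 + 16 * GF ^ 2 * Gp ^ 2 + 4 * LF ^ 2 + 4 * B ^ 2 * Lp ^ 2 ≤ L ^ 2)
    (hx : x ∈ Q.box) (hy : y ∈ Q.box) : Q.F y - Q.F x ≤ ⟪Q.gradF x, y⟫_ℝ := by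
  classical
  let h : Fin n → ℝ := fun i => max (y i - x i) 0
  have hh0 : ∀ i, 0 ≤ h i := fun i => le_max_right _ _
  have hhu : ∀ i, x i + h i ≤ Q.u i := fun i => by
    rcases max_cases (y i - x i) 0 with ⟨e, -⟩ | ⟨e, -⟩
    · simp only [h, e]; linarith [(hy i).2]
    · simp only [h, e]; linarith [(hx i).2]
  have hhy : ∀ i, h i ≤ y i := fun i => max_le (by linarith [(hx i).1]) (hy i).1
  let w : Finset (Fin n) → EuclideanSpace ℝ (Fin n) := fun s =>
    WithLp.toLp 2 fun i => x i + if i ∈ s then h i else 0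
  have hw : ∀ s, w s ∈ Q.box := by
    intro s i
    by_cases hi : i ∈ s
    · simpa [w, hi] using ⟨add_nonneg (hx i).1 (hh0 i), hhu i⟩
    · simpa [w, hi] using hx i
  -- The coordinates of h are added one at a time; each gain is at most the gain of the same
  -- increment made at x.
  have hsum : ∀ s : Finset (Fin n), Q.F (w s) - Q.F x ≤ ∑ i ∈ s, h i * Q.gradF x i := by
    intro s
    induction s using Finset.induction_on with
    | empty => simp [w]
    | insert i s hi ih =>
      have h1 : w (insert i s) = w s + EuclideanSpace.single i (h i) := by
        ext j
        rcases eq_or_ne j i with rfl | hj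
        · simp [w, hi]
        · simp [w, hj]
      have h2 : x + EuclideanSpace.single i (h i) ∈ Q.box := by
        intro j
        rcases eq_or_ne j i with rfl | hj
        · simpa using ⟨add_nonneg (hx j).1 (hh0 j), hhu j⟩
        · simpa [hj] using hx j
      have h3 := hQ.dr x hx (w s) (hw s) (fun j => by
        by_cases hj : j ∈ s
        · simpa [w, hj] using hh0 j
        · simp [w, hj]) i (h i) (hh0 i) h2 (by rw [← h1]; exact hw _)
      rw [← h1] at h3
      rw [Finset.sum_insert hi]
      linarith [hQ.F_add_single_sub_le hL0 hL hx i (hh0 i) h2]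
  have hmono := hQ.monotone y hy (w Finset.univ) (hw _) fun i => by
    simp only [w, Finset.mem_univ, if_true]
    linarith [le_max_left (y i - x i) 0]
  have hle : ∑ i, h i * Q.gradF x i ≤ ⟪Q.gradF x, y⟫_ℝ := by
    rw [PiLp.inner_apply]
    refine Finset.sum_le_sum fun i _ => ?_
    simpa using mul_le_mul_of_nonneg_right (hhy i) (hQ.gradF_nonneg hL0 hL hx i)
  linarith [hsum Finset.univ]

end Assumptions

end StochProblem

/-! ### Minibatches as Markov kernels, and one step of the estimator. -/

section Kernels

/-- It suffices to test on the π-system of rectangles, whose measure is a finite product. -/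
theorem measurable_pi_const {Y X : Type*} [MeasurableSpace Y] [MeasurableSpace X] {M : ℕ}
    {μ : Y → Measure X} [∀ y, IsProbabilityMeasure (μ y)] (hμ : Measurable μ) :
    Measurable fun y => Measure.pi fun _ : Fin M => μ y := by
  refine Measurable.measure_of_isPiSystem_of_isProbabilityMeasure
    (generateFrom_pi (α := fun _ : Fin M => X)).symm isPiSystem_pi ?_
  rintro _ ⟨s, hs, rfl⟩
  simp only [Measure.pi_pi]
  exact Finset.measurable_fun_prod _ fun j _ => Measure.measurable_measure.1 hμ _ (hs j trivial)

/-- The integral of a function of a state and of a fresh sample. -/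
theorem lintegral_eq_lintegral_lintegral_kernel {Ω Y X : Type*} {mΩ : MeasurableSpace Ω}
    [MeasurableSpace Y] [MeasurableSpace X] {P : Measure Ω} [IsProbabilityMeasure P]
    (κ : Kernel Y X) [IsMarkovKernel κ] {W : Ω → Y} {S : Ω → X} (hW : Measurable W)
    (hS : Measurable S)
    (h : ∀ A, MeasurableSet A → ∀ U, MeasurableSet U →
      P (W ⁻¹' A ∩ S ⁻¹' U) = ∫⁻ ω in W ⁻¹' A, κ (W ω) U ∂P)
    {f : Y × X → ENNReal} (hf : Measurable f) :
    ∫⁻ ω, f (W ω, S ω) ∂P = ∫⁻ ω, ∫⁻ s, f (W ω, s) ∂(κ (W ω)) ∂P := by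
  have := Measure.isProbabilityMeasure_map (μ := P) hW.aemeasurable
  have := Measure.isProbabilityMeasure_map (μ := P) (hW.prodMk hS).aemeasurable
  -- A joint law is determined by its values on rectangles, which is what the hypothesis on W and S
  -- provides.
  have hmap : P.map (fun ω => (W ω, S ω)) = (P.map W) ⊗ₘ κ := by
    rw [Measure.ext_prod_iff]
    intro A U hA hU
    rw [Measure.compProd_apply_prod hA hU, Measure.map_apply (hW.prodMk hS) (hA.prod hU),
      setLIntegral_map hA (κ.measurable_coe hU) hW, ← h A hA U hU]
    rfl
  rw [← lintegral_map hf (hW.prodMk hS), hmap, Measure.lintegral_compProd hf,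
    lintegral_map hf.lintegral_kernel_prod_right' hW]

end Kernels

namespace StochProblem

variable {n : ℕ} {Z : Type*} [MeasurableSpace Z] {Q : StochProblem n Z}
  {D B GF LF Gp Lp L2F L2p L : ℝ}

theorem Assumptions.measurable_pairLaw (hQ : Q.Assumptions D B GF LF Gp Lp L2F L2p) :
    Measurable fun w : EuclideanSpace ℝ (Fin n) × EuclideanSpace ℝ (Fin n) =>
      Q.pairLaw (Q.clamp w.1) (Q.clamp w.2) := by
  have := hQ.sigmaFinite
  have hc : Measurable Q.clamp := continuous_clamp.measurable
  simp_rw [Assumptions.pairLaw_eq (clamp_mem hQ.u_pos _) (clamp_mem hQ.u_pos _)]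
  refine measurable_withDensity ?_
  have hseg : Measurable fun q : (EuclideanSpace ℝ (Fin n) × EuclideanSpace ℝ (Fin n)) × ℝ × Z =>
      segPoint (Q.clamp q.1.1) (Q.clamp q.1.2) q.2.1 := by
    unfold segPoint
    fun_prop
  exact (hQ.measurable_p_clamp.comp
    (hseg.prodMk (measurable_snd.comp measurable_snd))).ennreal_ofReal

theorem Assumptions.measurable_pi_pairLaw (hQ : Q.Assumptions D B GF LF Gp Lp L2F L2p) (M : ℕ) :
    Measurable fun w : EuclideanSpace ℝ (Fin n) × EuclideanSpace ℝ (Fin n)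
      × EuclideanSpace ℝ (Fin n) =>
        Measure.pi fun _ : Fin M => Q.pairLaw (Q.clamp w.1) (Q.clamp w.2.1) := by
  have : ∀ w : EuclideanSpace ℝ (Fin n) × EuclideanSpace ℝ (Fin n) × EuclideanSpace ℝ (Fin n),
      IsProbabilityMeasure (Q.pairLaw (Q.clamp w.1) (Q.clamp w.2.1)) := fun w =>
    hQ.isProbabilityMeasure_pairLaw (clamp_mem hQ.u_pos _) (clamp_mem hQ.u_pos _)
  have hm : Measurable fun w : EuclideanSpace ℝ (Fin n) × EuclideanSpace ℝ (Fin n)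
      × EuclideanSpace ℝ (Fin n) => Q.pairLaw (Q.clamp w.1) (Q.clamp w.2.1) :=
    Measurable.comp (g := fun w : EuclideanSpace ℝ (Fin n) × EuclideanSpace ℝ (Fin n) =>
      Q.pairLaw (Q.clamp w.1) (Q.clamp w.2)) (f := fun w : EuclideanSpace ℝ (Fin n)
        × EuclideanSpace ℝ (Fin n) × EuclideanSpace ℝ (Fin n) => (w.1, w.2.1))
      hQ.measurable_pairLaw (by fun_prop)
  exact measurable_pi_const hm

/-- The law of a minibatch, as a Markov kernel in the two endpoints and an idle third state. -/
noncomputable def Assumptions.batchKernel (hQ : Q.Assumptions D B GF LF Gp Lp L2F L2p) (M : ℕ) :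
    Kernel (EuclideanSpace ℝ (Fin n) × EuclideanSpace ℝ (Fin n) × EuclideanSpace ℝ (Fin n))
      (Fin M → ℝ × Z) where
  toFun w := Measure.pi fun _ : Fin M => Q.pairLaw (Q.clamp w.1) (Q.clamp w.2.1)
  measurable' := hQ.measurable_pi_pairLaw M

theorem Assumptions.batchKernel_apply (hQ : Q.Assumptions D B GF LF Gp Lp L2F L2p) (M : ℕ)
    (w : EuclideanSpace ℝ (Fin n) × EuclideanSpace ℝ (Fin n) × EuclideanSpace ℝ (Fin n)) :
    hQ.batchKernel M w = Measure.pi fun _ : Fin M => Q.pairLaw (Q.clamp w.1) (Q.clamp w.2.1) :=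
  rfl

theorem Assumptions.isMarkovKernel_batchKernel (hQ : Q.Assumptions D B GF LF Gp Lp L2F L2p)
    (M : ℕ) : IsMarkovKernel (hQ.batchKernel M) := by
  constructor
  intro w
  have := hQ.isProbabilityMeasure_pairLaw (clamp_mem hQ.u_pos w.1) (clamp_mem hQ.u_pos w.2.1)
  rw [batchKernel_apply]
  infer_instance

/-- The increment of the gradient estimate, with the evaluation points retracted to the box. -/
noncomputable def gradStep (Q : StochProblem n Z) {M : ℕ} (x y : EuclideanSpace ℝ (Fin n))
    (s : Fin M → ℝ × Z) : EuclideanSpace ℝ (Fin n) :=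
  (M : ℝ)⁻¹ • ∑ j, Q.hessEst (Q.clamp (segPoint x y (s j).1)) (s j).2 (x - y)

theorem Assumptions.measurable_gradStep (hQ : Q.Assumptions D B GF LF Gp Lp L2F L2p) (M : ℕ) :
    Measurable fun q : (EuclideanSpace ℝ (Fin n) × EuclideanSpace ℝ (Fin n)) × (Fin M → ℝ × Z) =>
      Q.gradStep q.1.1 q.1.2 q.2 := by
  have hterm : ∀ j : Fin M, Measurable
      fun q : (EuclideanSpace ℝ (Fin n) × EuclideanSpace ℝ (Fin n)) × (Fin M → ℝ × Z) =>
        Q.hessEst (Q.clamp (segPoint q.1.1 q.1.2 (q.2 j).1)) (q.2 j).2 (q.1.1 - q.1.2) := by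
    intro j
    have hseg : Measurable
        fun q : (EuclideanSpace ℝ (Fin n) × EuclideanSpace ℝ (Fin n)) × (Fin M → ℝ × Z) =>
          segPoint q.1.1 q.1.2 (q.2 j).1 := by
      unfold segPoint
      fun_prop
    have hz : Measurable
        fun q : (EuclideanSpace ℝ (Fin n) × EuclideanSpace ℝ (Fin n)) × (Fin M → ℝ × Z) =>
          (q.2 j).2 := by fun_prop
    have hd : Measurable
        fun q : (EuclideanSpace ℝ (Fin n) × EuclideanSpace ℝ (Fin n)) × (Fin M → ℝ × Z) =>
          q.1.1 - q.1.2 := by fun_prop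
    have hH := (stronglyMeasurable_uncurry_clamp hQ.u_pos hQ.continuousOn_hessEst
      fun _ hx => hQ.measurable_hessEst hx).comp_measurable (hseg.prodMk hz)
    exact (isBoundedBilinearMap_apply.continuous.comp_stronglyMeasurable
      (hH.prodMk hd.stronglyMeasurable)).measurable
  unfold gradStep
  exact (measurable_const_smul _).comp (Finset.measurable_fun_sum _ fun j _ => hterm j)

/-- The conditional mean square of the error after one step. -/
theorem Assumptions.lintegral_gradStep_le (hQ : Q.Assumptions D B GF LF Gp Lp L2F L2p)
    (hL : 4 * B ^ 2 * Gp ^ 4 + 16 * GF ^ 2 * Gp ^ 2 + 4 * LF ^ 2 + 4 * B ^ 2 * Lp ^ 2 ≤ L ^ 2)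
    {M : ℕ} (hM : 0 < M) {x y : EuclideanSpace ℝ (Fin n)} (hx : x ∈ Q.box) (hy : y ∈ Q.box)
    (e : EuclideanSpace ℝ (Fin n)) :
    ∫⁻ s, ENNReal.ofReal (‖e + (Q.gradStep x y s - (Q.gradF x - Q.gradF y))‖ ^ 2)
        ∂(Measure.pi fun _ : Fin M => Q.pairLaw x y)
      ≤ ENNReal.ofReal (‖e‖ ^ 2 + (M : ℝ)⁻¹ * (L ^ 2 * ‖x - y‖ ^ 2)) := by
  have := hQ.isProbabilityMeasure_pairLaw hx hy
  -- The parameter lies in [0, 1] almost surely, so the retraction is invisible under `pairLaw`.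
  have hae : ∀ᵐ az ∂(Q.pairLaw x y), Q.hessEst (segPoint x y az.1) az.2
      = Q.hessEst (Q.clamp (segPoint x y az.1)) az.2 := by
    filter_upwards [Assumptions.ae_pairLaw_mem_Icc (Q := Q) (x := x) (y := y)] with az haz
    rw [clamp_eq_self (segPoint_mem hx hy haz)]
  obtain ⟨hm, hle⟩ := hQ.memLp_hessEst_pairLaw hL hx hy
  have hm' := hm.ae_eq hae
  have hf : MemLp (fun az : ℝ × Z => Q.hessEst (Q.clamp (segPoint x y az.1)) az.2 (x - y)) 2
      (Q.pairLaw x y) :=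
    ((ContinuousLinearMap.apply ℝ (EuclideanSpace ℝ (Fin n))) (x - y)).comp_memLp' hm'
  have hmean : ∫ az, Q.hessEst (Q.clamp (segPoint x y az.1)) az.2 (x - y) ∂Q.pairLaw x y
      = Q.gradF x - Q.gradF y := by
    rw [hQ.gradF_sub_eq_integral_pairLaw hL hx hy]
    refine integral_congr_ae ?_
    filter_upwards [hae] with az h
    rw [h]
  have hsq : ∫ az, ‖Q.hessEst (Q.clamp (segPoint x y az.1)) az.2 (x - y)‖ ^ 2 ∂Q.pairLaw x y
      ≤ L ^ 2 * ‖x - y‖ ^ 2 := by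
    calc _ ≤ ∫ az, ‖Q.hessEst (segPoint x y az.1) az.2‖ ^ 2 * ‖x - y‖ ^ 2 ∂Q.pairLaw x y := by
          refine integral_mono_of_nonneg (ae_of_all _ fun _ => by positivity)
            (((memLp_two_iff_integrable_sq_norm hm.1).1 hm).mul_const _) ?_
          filter_upwards [hae] with az h
          rw [← h, ← mul_pow]
          exact pow_le_pow_left₀ (norm_nonneg _) (ContinuousLinearMap.le_opNorm _ _) 2
      _ ≤ _ := by
          rw [integral_mul_const]
          gcongr
  have key := lintegral_pi_norm_sq_add_average_sub_le hM (Q.pairLaw x y) hf e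
  rw [hmean] at key
  refine key.trans (ENNReal.ofReal_le_ofReal ?_)
  gcongr

/-! ### The mean-square error of the gradient estimates along a run. -/

namespace IsSCGPlusRun

variable {T M₀ M : ℕ} {Ω : Type*} {mΩ : MeasurableSpace Ω} {P : Measure Ω}
  {ℱ : Filtration ℕ mΩ} {x v g : ℕ → Ω → EuclideanSpace ℝ (Fin n)}
  {S₀ : Ω → Fin M₀ → Z} {S : ℕ → Ω → Fin M → ℝ × Z}

theorem x_mem_box (h : Q.IsSCGPlusRun T M₀ M P ℱ x v g S₀ S)
    (hQ : Q.Assumptions D B GF LF Gp Lp L2F L2p) (ω : Ω) {t : ℕ} (ht : t ≤ T) :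
    x t ω ∈ Q.box := by
  -- The induction needs the sharper bound x_t ≤ (t/T) u, since each step adds at most u/T.
  suffices hs : ∀ t ≤ T, ∀ i, 0 ≤ x t ω i ∧ x t ω i ≤ (t / T : ℝ) * Q.u i by
    intro i
    refine ⟨(hs t ht i).1, (hs t ht i).2.trans ?_⟩
    have : (t / T : ℝ) ≤ 1 := div_le_one_of_le₀ (by exact_mod_cast ht) (by positivity)
    nlinarith [hQ.u_pos i]
  intro t
  induction t with
  | zero => intro _ i; simp [h.x_zero]
  | succ t ih =>
    intro ht i
    have hv := hQ.C_subset (h.v_mem t ht ω) i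
    obtain ⟨h0, h1⟩ := ih (by omega) i
    have hT : (0 : ℝ) ≤ 1 / T := by positivity
    rw [h.x_succ t ht]
    simp only [PiLp.add_apply, PiLp.smul_apply, smul_eq_mul]
    refine ⟨add_nonneg h0 (mul_nonneg hT hv.1), ?_⟩
    have := mul_le_mul_of_nonneg_left hv.2 hT
    have e : ((t + 1 : ℕ) / T : ℝ) * Q.u i = t / T * Q.u i + 1 / T * Q.u i := by
      push_cast; ring
    rw [e]
    linarith

theorem norm_x_succ_sub_le (h : Q.IsSCGPlusRun T M₀ M P ℱ x v g S₀ S)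
    (hQ : Q.Assumptions D B GF LF Gp Lp L2F L2p) (ω : Ω) {t : ℕ} (ht : t < T) :
    ‖x (t + 1) ω - x t ω‖ ≤ D / T := by
  rw [h.x_succ t ht, add_sub_cancel_left, norm_smul, Real.norm_of_nonneg (by positivity),
    one_div, div_eq_inv_mul]
  exact mul_le_mul_of_nonneg_left (hQ.norm_le _ (h.v_mem t ht ω)) (by positivity)

theorem measurable_x (h : Q.IsSCGPlusRun T M₀ M P ℱ x v g S₀ S) {t : ℕ} (ht : t ≤ T) :
    Measurable[ℱ t] (x t) := by
  induction t with
  | zero =>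
    have : x 0 = fun _ => 0 := funext h.x_zero
    rw [this]
    exact measurable_const
  | succ t ih =>
    have : x (t + 1) = fun ω => x t ω + (1 / (T : ℝ)) • v t ω := funext (h.x_succ t ht)
    rw [this]
    exact ((ih (by omega)).mono (ℱ.mono (Nat.le_succ t)) le_rfl).add
      ((measurable_const_smul _).comp (h.v_measurable t ht))

/-- The gradient estimates of a run, with the evaluation points retracted to the box. -/
noncomputable def _root_.StochProblem.clampedEst (Q : StochProblem n Z)
    (x : ℕ → Ω → EuclideanSpace ℝ (Fin n)) (S₀ : Ω → Fin M₀ → Z) (S : ℕ → Ω → Fin M → ℝ × Z) :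
    ℕ → Ω → EuclideanSpace ℝ (Fin n)
  | 0, ω => (M₀ : ℝ)⁻¹ • ∑ j, Q.gradEst 0 (S₀ ω j)
  | t + 1, ω => clampedEst Q x S₀ S t ω + Q.gradStep (x (t + 1) ω) (x t ω) (S (t + 1) ω)

/-- The error of the gradient estimates. -/
noncomputable def _root_.StochProblem.estErr (Q : StochProblem n Z)
    (x : ℕ → Ω → EuclideanSpace ℝ (Fin n)) (S₀ : Ω → Fin M₀ → Z) (S : ℕ → Ω → Fin M → ℝ × Z)
    (t : ℕ) (ω : Ω) : EuclideanSpace ℝ (Fin n) :=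
  Q.clampedEst x S₀ S t ω - Q.gradF (Q.clamp (x t ω))

theorem ae_sample_mem_Icc (h : Q.IsSCGPlusRun T M₀ M P ℱ x v g S₀ S)
    (hQ : Q.Assumptions D B GF LF Gp Lp L2F L2p) {t : ℕ} (ht : t + 1 < T) :
    ∀ᵐ ω ∂P, ∀ j, (S (t + 1) ω j).1 ∈ Icc (0 : ℝ) 1 := by
  rw [ae_all_iff]
  intro j
  have hU : MeasurableSet {s : Fin M → ℝ × Z | (s j).1 ∉ Icc (0 : ℝ) 1} :=
    (measurableSet_Icc.preimage (measurable_fst.comp (measurable_pi_apply j))).compl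
  have hlaw := h.S_law t ht univ MeasurableSet.univ _ hU
  rw [univ_inter, Measure.restrict_univ] at hlaw
  rw [ae_iff]
  refine hlaw.trans ((lintegral_congr fun ω => ?_).trans lintegral_zero)
  have := hQ.isProbabilityMeasure_pairLaw (h.x_mem_box hQ ω ht.le)
    (h.x_mem_box hQ ω ((Nat.le_succ t).trans ht.le))
  have hae := (measurePreserving_eval (fun _ : Fin M => Q.pairLaw (x (t + 1) ω) (x t ω))
    j).quasiMeasurePreserving.ae (Assumptions.ae_pairLaw_mem_Icc (Q := Q))
  exact ae_iff.1 hae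

/-- The two estimates differ only if some sampled parameter leaves [0, 1], which has probability
zero. The retracted version is the one that is jointly measurable. -/
theorem ae_g_eq_clampedEst (h : Q.IsSCGPlusRun T M₀ M P ℱ x v g S₀ S)
    (hQ : Q.Assumptions D B GF LF Gp Lp L2F L2p) :
    ∀ᵐ ω ∂P, ∀ t < T, g t ω = Q.clampedEst x S₀ S t ω := by
  have hall : ∀ᵐ ω ∂P, ∀ t, t + 1 < T → ∀ j, (S (t + 1) ω j).1 ∈ Icc (0 : ℝ) 1 := by
    rw [ae_all_iff]
    intro t
    by_cases ht : t + 1 < T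
    · filter_upwards [h.ae_sample_mem_Icc hQ ht] with ω hω _ using hω
    · exact ae_of_all _ fun ω ht' => absurd ht' ht
  filter_upwards [hall] with ω hω t
  induction t with
  | zero => intro _; exact h.g_zero ω
  | succ t ih =>
    intro ht
    rw [h.g_succ t ht, ih (by omega), clampedEst, gradStep]
    congr 1
    simp only [smul_apply, sum_apply]
    congr 1
    refine Finset.sum_congr rfl fun j _ => ?_
    rw [clamp_eq_self (segPoint_mem (h.x_mem_box hQ ω ht.le)
      (h.x_mem_box hQ ω ((Nat.le_succ t).trans ht.le)) (hω t ht j))]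
    rfl

theorem measurable_clampedEst (h : Q.IsSCGPlusRun T M₀ M P ℱ x v g S₀ S)
    (hQ : Q.Assumptions D B GF LF Gp Lp L2F L2p) {t : ℕ} (ht : t < T) :
    Measurable[ℱ (t + 1)] (Q.clampedEst x S₀ S t) := by
  induction t with
  | zero =>
    have hm : Measurable fun s : Fin M₀ → Z => (M₀ : ℝ)⁻¹ • ∑ j, Q.gradEst 0 (s j) :=
      (measurable_const_smul _).comp (Finset.measurable_fun_sum _ fun j _ =>
        (hQ.measurable_gradEst (zero_mem_box hQ.u_pos)).measurable.comp (measurable_pi_apply j))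
    exact hm.comp h.S₀_measurable
  | succ t ih =>
    have h1 := (ih (by omega)).mono (ℱ.mono (Nat.le_succ (t + 1))) le_rfl
    have h2 := (h.measurable_x ht.le).mono (ℱ.mono (Nat.le_succ (t + 1))) le_rfl
    have h3 := (h.measurable_x ((Nat.le_succ t).trans ht.le)).mono
      (ℱ.mono ((Nat.le_succ t).trans (Nat.le_succ (t + 1)))) le_rfl
    have h4 : Measurable[ℱ (t + 1 + 1)]
        fun ω => Q.gradStep (x (t + 1) ω) (x t ω) (S (t + 1) ω) :=
      (hQ.measurable_gradStep M).comp (f := fun ω => ((x (t + 1) ω, x t ω), S (t + 1) ω))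
        ((h2.prodMk h3).prodMk (h.S_measurable t ht))
    exact h1.add h4

theorem _root_.StochProblem.Assumptions.measurable_gradF_clamp
    (hQ : Q.Assumptions D B GF LF Gp Lp L2F L2p) (hL0 : 0 ≤ L)
    (hL : 4 * B ^ 2 * Gp ^ 4 + 16 * GF ^ 2 * Gp ^ 2 + 4 * LF ^ 2 + 4 * B ^ 2 * Lp ^ 2 ≤ L ^ 2) :
    Measurable fun x => Q.gradF (Q.clamp x) :=
  ((hQ.continuousOn_gradF hL0 hL).comp_continuous continuous_clamp (clamp_mem hQ.u_pos)).measurable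

theorem measurable_estErr (h : Q.IsSCGPlusRun T M₀ M P ℱ x v g S₀ S)
    (hQ : Q.Assumptions D B GF LF Gp Lp L2F L2p) (hL0 : 0 ≤ L)
    (hL : 4 * B ^ 2 * Gp ^ 4 + 16 * GF ^ 2 * Gp ^ 2 + 4 * LF ^ 2 + 4 * B ^ 2 * Lp ^ 2 ≤ L ^ 2)
    {t : ℕ} (ht : t < T) : Measurable[ℱ (t + 1)] (Q.estErr x S₀ S t) :=
  (h.measurable_clampedEst hQ ht).sub ((hQ.measurable_gradF_clamp hL0 hL).comp
    ((h.measurable_x ht.le).mono (ℱ.mono (Nat.le_succ t)) le_rfl))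

theorem lintegral_estErr_zero_le (h : Q.IsSCGPlusRun T M₀ M P ℱ x v g S₀ S)
    [IsProbabilityMeasure P]
    (hQ : Q.Assumptions D B GF LF Gp Lp L2F L2p) (hM₀ : 0 < M₀) :
    ∫⁻ ω, ENNReal.ofReal (‖Q.estErr x S₀ S 0 ω‖ ^ 2) ∂P
      ≤ ENNReal.ofReal ((M₀ : ℝ)⁻¹ * (GF + B * Gp) ^ 2) := by
  have h0 := zero_mem_box hQ.u_pos
  have := hQ.p_prob 0 h0
  have hS : Measurable S₀ := h.S₀_measurable.mono (ℱ.le 1) le_rfl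
  have hmap : P.map S₀ = Measure.pi fun _ : Fin M₀ => Q.sampleLaw 0 := by
    ext U hU
    rw [Measure.map_apply hS hU]
    simpa using h.S₀_law univ MeasurableSet.univ U hU
  obtain ⟨hm, hle⟩ := hQ.memLp_gradEst h0
  have key := lintegral_pi_norm_sq_add_average_sub_le hM₀ (Q.sampleLaw 0) hm 0
  rw [← hmap, lintegral_map _ hS] at key
  · calc _ ≤ _ := le_of_eq ?_
      _ ≤ _ := key
      _ ≤ _ := ENNReal.ofReal_le_ofReal (by rw [norm_zero]; simp; gcongr)
    refine lintegral_congr fun ω => ?_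
    rw [zero_add]
    simp only [estErr, clampedEst, h.x_zero, clamp_eq_self h0]
    rfl
  · have hm' := (hQ.measurable_gradEst h0).measurable
    fun_prop

/-- Given the past, the new error is the old one plus a centred average of M samples. The cross term
vanishes, and the added variance is at most L²(D/T)²/M. -/
theorem lintegral_estErr_succ_le (h : Q.IsSCGPlusRun T M₀ M P ℱ x v g S₀ S)
    [IsProbabilityMeasure P]
    (hQ : Q.Assumptions D B GF LF Gp Lp L2F L2p) (hL0 : 0 ≤ L)
    (hL : 4 * B ^ 2 * Gp ^ 4 + 16 * GF ^ 2 * Gp ^ 2 + 4 * LF ^ 2 + 4 * B ^ 2 * Lp ^ 2 ≤ L ^ 2)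
    (hM : 0 < M) {t : ℕ} (ht : t + 1 < T) :
    ∫⁻ ω, ENNReal.ofReal (‖Q.estErr x S₀ S (t + 1) ω‖ ^ 2) ∂P
      ≤ ∫⁻ ω, ENNReal.ofReal (‖Q.estErr x S₀ S t ω‖ ^ 2) ∂P
        + ENNReal.ofReal ((M : ℝ)⁻¹ * (L ^ 2 * (D / T) ^ 2)) := by
  have ht' : t < T := (Nat.lt_succ_self t).trans ht
  have hmem := fun ω => h.x_mem_box hQ ω ht.le
  have hmem' := fun ω => h.x_mem_box hQ ω ht'.le
  have := hQ.isMarkovKernel_batchKernel M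
  -- The old error is carried as part of the state, so that the conditional law of the batch can be
  -- integrated against a function of both.
  let W : Ω → EuclideanSpace ℝ (Fin n) × EuclideanSpace ℝ (Fin n) × EuclideanSpace ℝ (Fin n) :=
    fun ω => (x (t + 1) ω, x t ω, Q.estErr x S₀ S t ω)
  have hWm : Measurable[ℱ (t + 1)] W :=
    (h.measurable_x ht.le).prodMk
      (((h.measurable_x ht'.le).mono (ℱ.mono (Nat.le_succ t)) le_rfl).prodMk
        (h.measurable_estErr hQ hL0 hL ht'))
  have hS : Measurable (S (t + 1)) := (h.S_measurable t ht).mono (ℱ.le _) le_rfl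
  have hlaw : ∀ A, MeasurableSet A → ∀ U, MeasurableSet U →
      P (W ⁻¹' A ∩ S (t + 1) ⁻¹' U) = ∫⁻ ω in W ⁻¹' A, hQ.batchKernel M (W ω) U ∂P := by
    intro A hA U hU
    rw [h.S_law t ht _ (hWm hA) U hU]
    refine lintegral_congr fun ω => ?_
    rw [hQ.batchKernel_apply, clamp_eq_self (hmem ω), clamp_eq_self (hmem' ω)]
  let f : (EuclideanSpace ℝ (Fin n) × EuclideanSpace ℝ (Fin n) × EuclideanSpace ℝ (Fin n))
      × (Fin M → ℝ × Z) → ENNReal := fun q => ENNReal.ofReal (‖q.1.2.2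
        + (Q.gradStep q.1.1 q.1.2.1 q.2 - (Q.gradF (Q.clamp q.1.1)
          - Q.gradF (Q.clamp q.1.2.1)))‖ ^ 2)
  have hf : Measurable f := by
    have h1 := (hQ.measurable_gradStep M).comp (f := fun q : (EuclideanSpace ℝ (Fin n)
      × EuclideanSpace ℝ (Fin n) × EuclideanSpace ℝ (Fin n)) × (Fin M → ℝ × Z) =>
        ((q.1.1, q.1.2.1), q.2)) (by fun_prop)
    have h2 := hQ.measurable_gradF_clamp hL0 hL
    have h3 := h2.comp (f := fun q : (EuclideanSpace ℝ (Fin n)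
      × EuclideanSpace ℝ (Fin n) × EuclideanSpace ℝ (Fin n)) × (Fin M → ℝ × Z) => q.1.1)
      (by fun_prop)
    have h4 := h2.comp (f := fun q : (EuclideanSpace ℝ (Fin n)
      × EuclideanSpace ℝ (Fin n) × EuclideanSpace ℝ (Fin n)) × (Fin M → ℝ × Z) => q.1.2.1)
      (by fun_prop)
    have h5 : Measurable fun q : (EuclideanSpace ℝ (Fin n)
      × EuclideanSpace ℝ (Fin n) × EuclideanSpace ℝ (Fin n)) × (Fin M → ℝ × Z) => q.1.2.2 := by
      fun_prop
    exact ((h5.add (h1.sub (h3.sub h4))).norm.pow_const 2).ennreal_ofReal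
  have hstep : ∀ ω, ENNReal.ofReal (‖Q.estErr x S₀ S (t + 1) ω‖ ^ 2) = f (W ω, S (t + 1) ω) := by
    intro ω
    simp only [f, W, estErr, clampedEst]
    congr 3
    abel
  rw [lintegral_congr hstep, lintegral_eq_lintegral_lintegral_kernel (hQ.batchKernel M)
    (hWm.mono (ℱ.le _) le_rfl) hS hlaw hf]
  refine le_of_le_of_eq (b := ∫⁻ ω, (ENNReal.ofReal (‖Q.estErr x S₀ S t ω‖ ^ 2)
    + ENNReal.ofReal ((M : ℝ)⁻¹ * (L ^ 2 * (D / T) ^ 2))) ∂P) ?_ (by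
      rw [lintegral_add_right _ measurable_const, lintegral_const, measure_univ, mul_one])
  refine lintegral_mono fun ω => ?_
  rw [hQ.batchKernel_apply, ← ENNReal.ofReal_add (by positivity) (by positivity)]
  simp only [f, W, clamp_eq_self (hmem ω), clamp_eq_self (hmem' ω)]
  refine (hQ.lintegral_gradStep_le hL hM (hmem ω) (hmem' ω) _).trans (ENNReal.ofReal_le_ofReal ?_)
  have := h.norm_x_succ_sub_le hQ ω ht'
  gcongr

theorem lintegral_estErr_le (h : Q.IsSCGPlusRun T M₀ M P ℱ x v g S₀ S)
    [IsProbabilityMeasure P]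
    (hQ : Q.Assumptions D B GF LF Gp Lp L2F L2p) (hL0 : 0 ≤ L)
    (hL : 4 * B ^ 2 * Gp ^ 4 + 16 * GF ^ 2 * Gp ^ 2 + 4 * LF ^ 2 + 4 * B ^ 2 * Lp ^ 2 ≤ L ^ 2)
    (hM₀ : 0 < M₀) (hM : 0 < M) {t : ℕ} (ht : t < T) :
    ∫⁻ ω, ENNReal.ofReal (‖Q.estErr x S₀ S t ω‖ ^ 2) ∂P
      ≤ ENNReal.ofReal ((M₀ : ℝ)⁻¹ * (GF + B * Gp) ^ 2
        + t * ((M : ℝ)⁻¹ * (L ^ 2 * (D / T) ^ 2))) := by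
  induction t with
  | zero => simpa using h.lintegral_estErr_zero_le hQ hM₀
  | succ t ih =>
    refine (h.lintegral_estErr_succ_le hQ hL0 hL hM ht).trans ?_
    refine (add_le_add_left (ih (by omega)) _).trans ?_
    rw [← ENNReal.ofReal_add (by positivity) (by positivity)]
    refine ENNReal.ofReal_le_ofReal (le_of_eq ?_)
    push_cast
    ring

end IsSCGPlusRun

end StochProblem

/-! ### The confidence radius and the continuous-greedy analysis. -/

/-- The numerical inequality behind the choice of the confidence radius. -/
theorem confidence_radius_bound {T : ℕ} (hT : 1 ≤ T) {q : ℝ} (hq : 0 < q) (hq1 : q ≤ 1) :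
    0 ≤ 1 / Real.sqrt q * (1 / Real.sqrt T) - ((T : ℝ) - 1) / (2 * (T : ℝ) ^ 2) ∧
    1 / (T : ℝ) ^ 2 + ((T : ℝ) - 1) / (2 * (T : ℝ) ^ 3)
      ≤ q * (1 / Real.sqrt q * (1 / Real.sqrt T) - ((T : ℝ) - 1) / (2 * (T : ℝ) ^ 2)) ^ 2 := by
  have hT1 : (1 : ℝ) ≤ T := by exact_mod_cast hT
  have hT0 : (0 : ℝ) < T := by linarith
  set s := Real.sqrt T with hs
  set w := Real.sqrt q with hw
  have hs0 : 0 < s := Real.sqrt_pos.2 hT0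
  have hw0 : 0 < w := Real.sqrt_pos.2 hq
  have hw1 : w ≤ 1 := Real.sqrt_le_one.2 hq1
  have hss : s ^ 2 = T := Real.sq_sqrt hT0.le
  have hww : w ^ 2 = q := Real.sq_sqrt hq.le
  -- After multiplication by T² the claim reads 1 + y ≤ (s − w y)². Since w ≤ 1 and (1 + y/2)² ≥ 1 +
  -- y, it is enough that 1 + (3/2) y ≤ s.
  set y : ℝ := ((T : ℝ) - 1) / (2 * T) with hy
  have hy0 : 0 ≤ y := div_nonneg (by linarith) (by positivity)
  have hyT : y * (2 * T) = T - 1 := by rw [hy]; field_simp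
  have hsy : 1 + 3 / 2 * y ≤ s := by
    rcases hT.eq_or_lt with h1 | h2
    · have : (T : ℝ) = 1 := by exact_mod_cast h1.symm
      have hs1 : s = 1 := by rw [hs, this, Real.sqrt_one]
      rw [hs1, hy, this]
      norm_num
    · have hT2 : (2 : ℝ) ≤ T := by exact_mod_cast h2
      -- With T − 1 = (s − 1)(s + 1), the inequality `h4` reduces to 3(s + 1) ≤ 4T, valid for T ≥ 2.
      have h3 : 3 * s ≤ 4 * T - 3 := abs_le_of_sq_le_sq' (by nlinarith) (by linarith) |>.2
      have hs1 : 1 ≤ s := Real.one_le_sqrt.2 hT1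
      have h4 : 3 * (T - 1) ≤ 4 * T * (s - 1) := by nlinarith
      nlinarith
  have e1 : ((T : ℝ) - 1) / (2 * (T : ℝ) ^ 2) = y / T := by rw [hy]; field_simp
  have e2 : 1 / (T : ℝ) ^ 2 + ((T : ℝ) - 1) / (2 * (T : ℝ) ^ 3) = (1 + y) / (T : ℝ) ^ 2 := by
    rw [hy]; field_simp
  have e3 : 1 / s = s / T := by rw [← hss]; field_simp
  have hc : w * (1 / w * (1 / s) - y / T) = (s - w * y) / T := by
    rw [e3]; field_simp
  have hlow : 1 + y / 2 ≤ s - w * y := by nlinarith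
  rw [e1, e2]
  constructor
  · refine le_of_mul_le_mul_left ?_ hw0
    rw [hc, mul_zero]
    exact div_nonneg (by linarith) hT0.le
  · rw [← hww, ← mul_pow, hc, div_pow]
    gcongr
    nlinarith

namespace StochProblem

variable {n : ℕ} {Z : Type*} [MeasurableSpace Z] {Q : StochProblem n Z}
  {D B GF LF Gp Lp L2F L2p L : ℝ}

theorem Assumptions.D_nonneg (hQ : Q.Assumptions D B GF LF Gp Lp L2F L2p) : 0 ≤ D :=
  let ⟨y, hy⟩ := hQ.C_nonempty
  (norm_nonneg y).trans (hQ.norm_le y hy)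

namespace IsSCGPlusRun

variable {T M₀ M : ℕ} {Ω : Type*} {mΩ : MeasurableSpace Ω} {P : Measure Ω}
  {ℱ : Filtration ℕ mΩ} {x v g : ℕ → Ω → EuclideanSpace ℝ (Fin n)}
  {S₀ : Ω → Fin M₀ → Z} {S : ℕ → Ω → Fin M → ℝ × Z}

/-- The progress made in one iteration. -/
theorem F_gap_succ_le (h : Q.IsSCGPlusRun T M₀ M P ℱ x v g S₀ S)
    (hQ : Q.Assumptions D B GF LF Gp Lp L2F L2p) (hL0 : 0 ≤ L)
    (hL : 4 * B ^ 2 * Gp ^ 4 + 16 * GF ^ 2 * Gp ^ 2 + 4 * LF ^ 2 + 4 * B ^ 2 * Lp ^ 2 ≤ L ^ 2)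
    {ω : Ω} {t : ℕ} (ht : t < T) (hg : g t ω = Q.clampedEst x S₀ S t ω)
    {y : EuclideanSpace ℝ (Fin n)} (hy : y ∈ Q.C) :
    Q.F y - Q.F (x (t + 1) ω) ≤ (1 - 1 / (T : ℝ)) * (Q.F y - Q.F (x t ω))
      + (D / T * ‖Q.estErr x S₀ S t ω‖ + L / 2 * (D / T) ^ 2) := by
  have hT : (0 : ℝ) < T := by exact_mod_cast (Nat.zero_le t).trans_lt ht
  have hx := h.x_mem_box hQ ω ht.le
  have hx' := h.x_mem_box hQ ω (Nat.succ_le_of_lt ht)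
  have hb := (abs_le.1 (hQ.abs_F_sub_sub_inner_le hL0 hL hx' hx)).1
  have hn := h.norm_x_succ_sub_le hQ ω ht
  have hsq : L / 2 * ‖x (t + 1) ω - x t ω‖ ^ 2 ≤ L / 2 * (D / T) ^ 2 := by gcongr
  have hdr := hQ.F_sub_le_inner_gradF hL0 hL hx (hQ.C_subset hy)
  have hmax := h.v_max t ht ω y hy
  have he : g t ω = Q.gradF (x t ω) + Q.estErr x S₀ S t ω := by
    rw [estErr, clamp_eq_self hx, hg]
    abel
  rw [he, inner_add_left, inner_add_left] at hmax
  -- The error is paired with v − y, a difference of two points of C, so it costs only one diameter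
  -- D.
  have hcs : ⟪Q.estErr x S₀ S t ω, v t ω - y⟫_ℝ ≤ ‖Q.estErr x S₀ S t ω‖ * D :=
    (real_inner_le_norm _ _).trans (mul_le_mul_of_nonneg_left
      (hQ.diam_le _ (h.v_mem t ht ω) _ hy) (norm_nonneg _))
  rw [inner_sub_right] at hcs
  have hv : Q.F y - Q.F (x t ω) - ‖Q.estErr x S₀ S t ω‖ * D
      ≤ ⟪Q.gradF (x t ω), v t ω⟫_ℝ := by linarith
  have hstep : ⟪Q.gradF (x t ω), x (t + 1) ω - x t ω⟫_ℝ
      = 1 / (T : ℝ) * ⟪Q.gradF (x t ω), v t ω⟫_ℝ := by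
    rw [h.x_succ t ht, add_sub_cancel_left, inner_smul_right]
  rw [hstep] at hb
  have := mul_le_mul_of_nonneg_left hv (by positivity : 0 ≤ 1 / (T : ℝ))
  have e : D / T * ‖Q.estErr x S₀ S t ω‖ = 1 / (T : ℝ) * (‖Q.estErr x S₀ S t ω‖ * D) := by ring
  rw [e]
  linarith

/-- The approximation guarantee along a run, in terms of the errors of the gradient estimates. -/
theorem F_last_ge (h : Q.IsSCGPlusRun T M₀ M P ℱ x v g S₀ S)
    (hQ : Q.Assumptions D B GF LF Gp Lp L2F L2p) (hL0 : 0 ≤ L)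
    (hL : 4 * B ^ 2 * Gp ^ 4 + 16 * GF ^ 2 * Gp ^ 2 + 4 * LF ^ 2 + 4 * B ^ 2 * Lp ^ 2 ≤ L ^ 2)
    (hT : 1 ≤ T) {ω : Ω} (hg : ∀ t < T, g t ω = Q.clampedEst x S₀ S t ω) :
    (1 - 1 / Real.exp 1) * Q.OPT - D / T * ∑ t ∈ Finset.range T, ‖Q.estErr x S₀ S t ω‖
      - L * D ^ 2 / (2 * T) ≤ Q.F (x T ω) := by
  have hT1 : (1 : ℝ) ≤ T := by exact_mod_cast hT
  have hD := hQ.D_nonneg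
  have hr0 : 0 ≤ 1 - 1 / (T : ℝ) := by
    rw [sub_nonneg, div_le_one (by linarith)]; exact hT1
  have hr1 : 1 - 1 / (T : ℝ) ≤ 1 := by
    have : 0 ≤ 1 / (T : ℝ) := by positivity
    linarith
  have hrT : (1 - 1 / (T : ℝ)) ^ T ≤ 1 / Real.exp 1 := by
    rw [one_div (Real.exp 1), ← Real.exp_neg]
    exact Real.one_sub_div_pow_le_exp_neg hT1
  have he1 : 0 < 1 - 1 / Real.exp 1 := by
    rw [sub_pos, div_lt_one (Real.exp_pos 1)]
    exact Real.one_lt_exp_iff.2 one_pos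
  have key : ∀ y ∈ Q.C, (1 - 1 / Real.exp 1) * Q.F y
      ≤ Q.F (x T ω) + D / T * ∑ t ∈ Finset.range T, ‖Q.estErr x S₀ S t ω‖
        + L * D ^ 2 / (2 * T) := by
    intro y hy
    have hchain : ∀ t ≤ T, Q.F y - Q.F (x t ω) ≤ (1 - 1 / (T : ℝ)) ^ t * (Q.F y - Q.F (x 0 ω))
        + ∑ s ∈ Finset.range t, (D / T * ‖Q.estErr x S₀ S s ω‖ + L / 2 * (D / T) ^ 2) := by
      intro t
      induction t with
      | zero => intro _; simp
      | succ t ih =>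
        intro ht
        have h1 := h.F_gap_succ_le hQ hL0 hL ht (hg t ht) hy
        have h2 := mul_le_mul_of_nonneg_left (ih (by omega)) hr0
        -- Errors already accumulated are nonnegative, so their contraction factor may be replaced
        -- by 1.
        have h3 : 0 ≤ ∑ s ∈ Finset.range t,
            (D / T * ‖Q.estErr x S₀ S s ω‖ + L / 2 * (D / T) ^ 2) :=
          Finset.sum_nonneg fun s _ => by positivity
        have h4 := mul_le_mul_of_nonneg_right hr1 h3
        rw [Finset.sum_range_succ, pow_succ]
        linarith
    have hF0 : 0 ≤ Q.F (x 0 ω) := by rw [h.x_zero]; exact hQ.F_zero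
    have hyF : Q.F (x 0 ω) ≤ Q.F y := by
      rw [h.x_zero]
      exact hQ.monotone _ (zero_mem_box hQ.u_pos) _ (hQ.C_subset hy)
        fun i => (hQ.C_subset hy i).1
    have h1 := hchain T le_rfl
    have h2 := mul_le_mul_of_nonneg_right hrT (sub_nonneg.2 hyF)
    have h3 : 1 / Real.exp 1 * (Q.F y - Q.F (x 0 ω)) ≤ 1 / Real.exp 1 * Q.F y :=
      mul_le_mul_of_nonneg_left (by linarith) (by positivity)
    rw [Finset.sum_add_distrib, ← Finset.mul_sum] at h1
    have h4 : ∑ _s ∈ Finset.range T, L / 2 * (D / (T : ℝ)) ^ 2 = L * D ^ 2 / (2 * T) := by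
      rw [Finset.sum_const, Finset.card_range, nsmul_eq_mul]
      field_simp
    rw [h4] at h1
    linarith
  -- The bound holds for every y in C, so it passes to the supremum; no maximizer has to be chosen.
  have hopt : Q.OPT ≤ (Q.F (x T ω) + D / T * ∑ t ∈ Finset.range T, ‖Q.estErr x S₀ S t ω‖
      + L * D ^ 2 / (2 * T)) / (1 - 1 / Real.exp 1) := by
    refine csSup_le (hQ.C_nonempty.image _) ?_
    rintro _ ⟨y, hy, rfl⟩
    rw [le_div_iff₀ he1, mul_comm]
    exact key y hy
  rw [le_div_iff₀ he1, mul_comm] at hopt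
  linarith

/-- The mean square of the averaged error. -/
theorem lintegral_sq_average_estErr_le {S : ℕ → Ω → Fin T → ℝ × Z}
    (h : Q.IsSCGPlusRun T M₀ T P ℱ x v g S₀ S)
    [IsProbabilityMeasure P]
    (hQ : Q.Assumptions D B GF LF Gp Lp L2F L2p) (hL0 : 0 ≤ L)
    (hL : 4 * B ^ 2 * Gp ^ 4 + 16 * GF ^ 2 * Gp ^ 2 + 4 * LF ^ 2 + 4 * B ^ 2 * Lp ^ 2 ≤ L ^ 2)
    (hT : 1 ≤ T) (hM₀ : 0 < M₀)
    (hB : (GF + B * Gp) ^ 2 * (T : ℝ) ^ 2 ≤ (M₀ : ℝ) * L ^ 2 * D ^ 2) :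
    ∫⁻ ω, ENNReal.ofReal ((D / T * ∑ t ∈ Finset.range T, ‖Q.estErr x S₀ S t ω‖) ^ 2) ∂P
      ≤ ENNReal.ofReal ((L * D ^ 2) ^ 2
        * (1 / (T : ℝ) ^ 2 + ((T : ℝ) - 1) / (2 * (T : ℝ) ^ 3))) := by
  have hT0 : (0 : ℝ) < T := by exact_mod_cast hT
  have hM0 : (0 : ℝ) < M₀ := by exact_mod_cast hM₀
  have hm : ∀ t ∈ Finset.range T, Measurable fun ω =>
      ENNReal.ofReal (‖Q.estErr x S₀ S t ω‖ ^ 2) := fun t ht =>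
    (((h.measurable_estErr hQ hL0 hL (Finset.mem_range.1 ht)).mono (ℱ.le _) le_rfl).norm.pow_const
      2).ennreal_ofReal
  have hinit : (M₀ : ℝ)⁻¹ * (GF + B * Gp) ^ 2 ≤ L ^ 2 * D ^ 2 / (T : ℝ) ^ 2 := by
    rw [le_div_iff₀ (by positivity), mul_assoc, inv_mul_le_iff₀ hM0, ← mul_assoc]
    exact hB
  have hsum : ∀ N : ℕ, ∑ t ∈ Finset.range N, (L ^ 2 * D ^ 2 / (T : ℝ) ^ 2
      + t * ((T : ℝ)⁻¹ * (L ^ 2 * (D / T) ^ 2)))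
      = L ^ 2 * D ^ 2 * (N / (T : ℝ) ^ 2 + N * ((N : ℝ) - 1) / (2 * (T : ℝ) ^ 3)) := by
    intro N
    induction N with
    | zero => simp
    | succ N ih =>
      rw [Finset.sum_range_succ, ih]
      push_cast
      field_simp
      ring
  calc _ ≤ ∫⁻ ω, ENNReal.ofReal (D ^ 2 / T)
        * ∑ t ∈ Finset.range T, ENNReal.ofReal (‖Q.estErr x S₀ S t ω‖ ^ 2) ∂P := by
        refine lintegral_mono fun ω => ?_
        rw [← ENNReal.ofReal_sum_of_nonneg fun _ _ => by positivity,
          ← ENNReal.ofReal_mul (by positivity)]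
        refine ENNReal.ofReal_le_ofReal ?_
        -- Cauchy–Schwarz for the sum of T error norms turns (D/T)² into the prefactor D²/T.
        have hcs := sq_sum_le_card_mul_sum_sq (s := Finset.range T)
          (f := fun t => ‖Q.estErr x S₀ S t ω‖)
        rw [Finset.card_range] at hcs
        calc _ = (D / T) ^ 2 * (∑ t ∈ Finset.range T, ‖Q.estErr x S₀ S t ω‖) ^ 2 := by ring
          _ ≤ (D / T) ^ 2 * (T * ∑ t ∈ Finset.range T, ‖Q.estErr x S₀ S t ω‖ ^ 2) := by gcongr
          _ = _ := by field_simp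
    _ = ENNReal.ofReal (D ^ 2 / T) * ∑ t ∈ Finset.range T,
        ∫⁻ ω, ENNReal.ofReal (‖Q.estErr x S₀ S t ω‖ ^ 2) ∂P := by
        rw [lintegral_const_mul _ (Finset.measurable_fun_sum _ hm), lintegral_finsetSum _ hm]
    _ ≤ ENNReal.ofReal (D ^ 2 / T) * ∑ t ∈ Finset.range T,
        ENNReal.ofReal (L ^ 2 * D ^ 2 / (T : ℝ) ^ 2
          + t * ((T : ℝ)⁻¹ * (L ^ 2 * (D / T) ^ 2))) := by
        gcongr with t ht
        refine (h.lintegral_estErr_le hQ hL0 hL hM₀ hT (Finset.mem_range.1 ht)).trans ?_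
        gcongr
    _ = _ := by
        rw [← ENNReal.ofReal_sum_of_nonneg fun _ _ => by positivity, hsum,
          ← ENNReal.ofReal_mul (by positivity)]
        congr 1
        field_simp

/-- The high-probability guarantee. -/
theorem lt_real_F_last_ge {S : ℕ → Ω → Fin T → ℝ × Z}
    (h : Q.IsSCGPlusRun T M₀ T P ℱ x v g S₀ S)
    [IsProbabilityMeasure P]
    (hQ : Q.Assumptions D B GF LF Gp Lp L2F L2p) (hL0 : 0 ≤ L)
    (hL : 4 * B ^ 2 * Gp ^ 4 + 16 * GF ^ 2 * Gp ^ 2 + 4 * LF ^ 2 + 4 * B ^ 2 * Lp ^ 2 ≤ L ^ 2)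
    (hT : 1 ≤ T) (hM₀ : 0 < M₀)
    (hB : (GF + B * Gp) ^ 2 * (T : ℝ) ^ 2 ≤ (M₀ : ℝ) * L ^ 2 * D ^ 2)
    {p : ℝ} (hp0 : 0 ≤ p) (hp1 : p < 1) :
    p < P.real {ω | (1 - 1 / Real.exp 1) * Q.OPT
            - L * D ^ 2 / Real.sqrt (1 - p) * (1 / Real.sqrt T)
            - L * D ^ 2 / (2 * (T : ℝ) ^ 2) ≤ Q.F (x T ω)} := by
  have hT0 : (0 : ℝ) < T := by exact_mod_cast hT
  have hq : 0 < 1 - p := by linarith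
  obtain ⟨hc0, hc⟩ := confidence_radius_bound hT hq (by linarith)
  -- The radius is chosen so that adding the deterministic loss 1/(2T) leaves exactly the stated
  -- 1/(√(1−p) √T) + 1/(2T²), in units of LD².
  set r := 1 / Real.sqrt (1 - p) * (1 / Real.sqrt T) - ((T : ℝ) - 1) / (2 * (T : ℝ) ^ 2) with hr
  let Y : Ω → ℝ := fun ω => D / T * ∑ t ∈ Finset.range T, ‖Q.estErr x S₀ S t ω‖
  have hY : Measurable Y :=
    (Finset.measurable_fun_sum _ fun t ht => ((h.measurable_estErr hQ hL0 hL
      (Finset.mem_range.1 ht)).mono (ℱ.le _) le_rfl).norm).const_mul _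
  have hlt : P {ω | L * D ^ 2 * r < Y ω} < ENNReal.ofReal (1 - p) := by
    refine measure_lt_lt_of_lintegral_sq_le hY hq (by positivity) ?_
    refine (h.lintegral_sq_average_estErr_le hQ hL0 hL hT hM₀ hB).trans
      (ENNReal.ofReal_le_ofReal ?_)
    calc _ ≤ (L * D ^ 2) ^ 2 * ((1 - p) * r ^ 2) := by gcongr
      _ = _ := by ring
  have hms : MeasurableSet {ω | L * D ^ 2 * r < Y ω} := measurableSet_lt measurable_const hY
  have hreal : P.real {ω | L * D ^ 2 * r < Y ω} < 1 - p := by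
    rw [Measure.real]
    exact (ENNReal.toReal_lt_of_lt_ofReal hlt)
  have hcompl := probReal_compl_eq_one_sub (μ := P) hms
  have hsub : P.real {ω | L * D ^ 2 * r < Y ω}ᶜ ≤ P.real {ω | (1 - 1 / Real.exp 1) * Q.OPT
            - L * D ^ 2 / Real.sqrt (1 - p) * (1 / Real.sqrt T)
            - L * D ^ 2 / (2 * (T : ℝ) ^ 2) ≤ Q.F (x T ω)} := by
    -- The inclusion of events holds almost everywhere, because the actual and retracted estimates
    -- agree only almost surely.
    refine ENNReal.toReal_mono (measure_ne_top _ _) (measure_mono_ae ?_)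
    filter_upwards [h.ae_g_eq_clampedEst hQ] with ω hω hle
    have hle' : Y ω ≤ L * D ^ 2 * r := not_lt.1 hle
    have hF := h.F_last_ge hQ hL0 hL hT hω
    refine le_trans ?_ hF
    have e : L * D ^ 2 * r = L * D ^ 2 / Real.sqrt (1 - p) * (1 / Real.sqrt T)
        + L * D ^ 2 / (2 * (T : ℝ) ^ 2) - L * D ^ 2 / (2 * T) := by
      rw [hr]
      field_simp
      ring
    rw [e] at hle'
    simp only [Y] at hle'
    linarith
  linarith

end IsSCGPlusRun

end StochProblem

/-! ### The query count and the rate in terms of queries. -/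

theorem scgPlusQueries_eq {T : ℕ} (hT : 1 ≤ T) (M₀ M : ℕ) :
    (scgPlusQueries T M₀ M : ℝ) = M₀ + ((T : ℝ) - 1) * M := by
  obtain ⟨m, rfl⟩ : ∃ m, T = m + 1 := ⟨T - 1, by omega⟩
  simp [scgPlusQueries, Finset.sum_range_succ']
  ring

/-- Since K ≤ κ'T², 1/√T is at most (κ'/K)^(1/4); and 1/T² ≤ 1/√T because T ≥ 1. -/
theorem confidence_error_le {T : ℕ} (hT : 1 ≤ T) {K κ' c w : ℝ} (hK : 0 < K) (hκ : 0 < κ')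
    (hKT : K ≤ κ' * (T : ℝ) ^ 2) (hc : 0 ≤ c) (hw : 0 ≤ w) :
    c / w * (1 / Real.sqrt T) + c / (2 * (T : ℝ) ^ 2)
      ≤ κ' ^ (1 / 4 : ℝ) * c * (1 / w + 1 / 2) / K ^ (1 / 4 : ℝ) := by
  have hT1 : (1 : ℝ) ≤ T := by exact_mod_cast hT
  have hT0 : (0 : ℝ) < T := by linarith
  have hs0 : 0 < Real.sqrt T := Real.sqrt_pos.2 hT0
  have hK4 : K ^ (1 / 4 : ℝ) ≤ κ' ^ (1 / 4 : ℝ) * Real.sqrt T := by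
    refine (Real.rpow_le_rpow hK.le hKT (by norm_num)).trans (le_of_eq ?_)
    rw [Real.mul_rpow hκ.le (by positivity), Real.sqrt_eq_rpow, ← Real.rpow_natCast,
      ← Real.rpow_mul hT0.le]
    norm_num
  have hKp : 0 < K ^ (1 / 4 : ℝ) := Real.rpow_pos_of_pos hK _
  have hκp : 0 < κ' ^ (1 / 4 : ℝ) := Real.rpow_pos_of_pos hκ _
  have hsT : Real.sqrt T ≤ (T : ℝ) ^ 2 := by
    refine Real.sqrt_le_iff.2 ⟨by positivity, ?_⟩
    rw [← pow_mul]
    exact le_self_pow₀ hT1 (by norm_num)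
  calc _ ≤ c / w * (1 / Real.sqrt T) + c / (2 * Real.sqrt T) := by gcongr
    _ = κ' ^ (1 / 4 : ℝ) * c * (1 / w + 1 / 2) / (κ' ^ (1 / 4 : ℝ) * Real.sqrt T) := by
        field_simp
    _ ≤ _ := by gcongr

end

theorem corollary2 (p : ℝ) (hp0 : 0 ≤ p) (hp1 : p < 1) (L D κ : ℝ) (hL : 0 ≤ L) :
    ∃ A : ℝ, ∀ (n : ℕ) (Z : Type*) [MeasurableSpace Z] (Q : StochProblem n Z)
      (B GF LF Gp Lp L2F L2p : ℝ),
      Q.Assumptions D B GF LF Gp Lp L2F L2p →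
      4 * B ^ 2 * Gp ^ 4 + 16 * GF ^ 2 * Gp ^ 2 + 4 * LF ^ 2 + 4 * B ^ 2 * Lp ^ 2 ≤ L ^ 2 →
      ∀ (T M₀ : ℕ), 1 ≤ T → 1 ≤ M₀ →
      (GF + B * Gp) ^ 2 * (T : ℝ) ^ 2 ≤ (M₀ : ℝ) * L ^ 2 * D ^ 2 →
      ∀ (Ω : Type*) (mΩ : MeasurableSpace Ω) (ℙ : MeasureTheory.Measure Ω)
        [MeasureTheory.IsProbabilityMeasure ℙ] (ℱ : MeasureTheory.Filtration ℕ mΩ)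
        (x v g : ℕ → Ω → EuclideanSpace ℝ (Fin n))
        (S₀ : Ω → Fin M₀ → Z) (S : ℕ → Ω → Fin T → ℝ × Z),
      Q.IsSCGPlusRun T M₀ T ℙ ℱ x v g S₀ S →
        p < ℙ.real {ω | (1 - 1 / Real.exp 1) * Q.OPT
            - L * D ^ 2 / Real.sqrt (1 - p) * (1 / Real.sqrt T)
            - L * D ^ 2 / (2 * (T : ℝ) ^ 2) ≤ Q.F (x T ω)} ∧
        ((M₀ : ℝ) ≤ κ * (T : ℝ) ^ 2 →
          3 / 4 * (T : ℝ) ^ 2 ≤ (scgPlusQueries T M₀ T : ℝ) ∧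
          (scgPlusQueries T M₀ T : ℝ) ≤ (κ + 1) * (T : ℝ) ^ 2 ∧
          p < ℙ.real {ω | (1 - 1 / Real.exp 1) * Q.OPT
            - A / (scgPlusQueries T M₀ T : ℝ) ^ (1 / 4 : ℝ) ≤ Q.F (x T ω)}) := by
  -- The two error terms contribute 1/√(1−p) and 1/2, and (κ + 1)^(1/4) converts 1/√T into K^(−1/4).
  refine ⟨(κ + 1) ^ (1 / 4 : ℝ) * (L * D ^ 2) * (1 / Real.sqrt (1 - p) + 1 / 2), ?_⟩
  intro n Z _ Q B GF LF Gp Lp L2F L2p hQ hLb T M₀ hT hM₀ hB Ω mΩ ℙ _ ℱ x v g S₀ S h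
  have hmain := h.lt_real_F_last_ge hQ hL hLb hT hM₀ hB hp0 hp1
  refine ⟨hmain, fun hκ => ?_⟩
  have hT1 : (1 : ℝ) ≤ T := by exact_mod_cast hT
  have hM1 : (1 : ℝ) ≤ M₀ := by exact_mod_cast hM₀
  rw [scgPlusQueries_eq hT]
  -- Using M₀ ≥ 1, the difference is at least 1 − T + T²/4 = (T/2 − 1)².
  have hK1 : 3 / 4 * (T : ℝ) ^ 2 ≤ M₀ + ((T : ℝ) - 1) * T := by
    nlinarith [sq_nonneg ((T : ℝ) / 2 - 1)]
  have hK2 : M₀ + ((T : ℝ) - 1) * T ≤ (κ + 1) * (T : ℝ) ^ 2 := by nlinarith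
  have hK0 : 0 < M₀ + ((T : ℝ) - 1) * T := by nlinarith
  -- No sign is assumed for κ; positivity of κ + 1 is forced by K > 0.
  have hκ0 : 0 < κ + 1 := pos_of_mul_pos_left (hK0.trans_le hK2) (by positivity)
  refine ⟨hK1, hK2, hmain.trans_le ?_⟩
  refine ENNReal.toReal_mono (MeasureTheory.measure_ne_top _ _)
    (MeasureTheory.measure_mono fun ω hω => ?_)
  have hbd := confidence_error_le hT hK0 hκ0 hK2 (by positivity : 0 ≤ L * D ^ 2)
    (Real.sqrt_nonneg (1 - p))
  simp only [Set.mem_ofPred_eq] at hω ⊢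
  linarith
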